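/- Let $\mathbb K$ be an algebraically closed field of characteristic $\neq 2$ and let $n\ge 2$. A *first-class $n$-Lie superalgebra* over $\mathbb K$ is a $\mathbb Z_2$-graded vector space $\mathfrak g=\mathfrak g_{\bar 0}\oplus\mathfrak g_{\bar 1}$ with an $n$-linear bracket such that, for homogeneous elements, $|[x_1,\dots,x_n]|=|x_1|+\cdots+|x_n|$, $[x_1,\dots,x_i,x_{i+1},\dots,x_n]=-(-1)^{|x_i||x_{i+1}|}[x_1,\dots,x_{i+1},x_i,\dots,x_n]$, and $$[x_1,\dots,x_{n-1},[y_1,\dots,y_n]]=\sum_{i=1}^n(-1)^{(|x_1|+\cdots+|x_{n-1}|)(|y_1|+\cdots+|y_{i-1}|)}[y_1,\dots,[x_1,\dots,x_{n-1},y_i],\dots,y_n].$$ Put $\mathfrak g^{0}=\mathfrak g$ and $\mathfrak g^{j+1}=[\mathfrak g^{j},\mathfrak g,\dots,\mathfrak g]$; $\mathfrak g$ is *nilpotent of length $k$* if $k$ is the smallest integer $\ge 0$ with $\mathfrak g^{k}=0$. It is *metric* if it carries a bilinear form $\langle\,,\rangle$ that is nondegenerate, consistent ($\langle x,y\rangle=0$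 if $|x|\ne|y|$), supersymmetric ($\langle x,y\rangle=(-1)^{|x||y|}\langle y,x\rangle$) and invariant ($\langle[x_1,\dots,x_{n-1},y],z\rangle=-(-1)^{(|x_1|+\cdots+|x_{n-1}|)|y|}\langle y,[x_1,\dots,x_{n-1},z]\rangle$). An *isometry* is a bijective linear map of degree $0$ preserving the brackets and the forms. A *graded ideal* is a graded subspace $I$ such that every bracket with an entry in $I$ lies in $I$. Let $\mathfrak b$ be a first-class $n$-Lie superalgebra with dual graded space $\mathfrak b^*$. For $\mathbf x=(x_1,\dots,x_{n-1})$ write $|\mathbf x|=|x_1|+\cdots+|x_{n-1}|$, $\mathbf x\cdot z=[x_1,\dots,x_{n-1},z]$ and, for $f\in\mathfrak b^*$, $(\mathrm{ad}^*(\mathbf x)f)(z)=-(-1)^{|\mathbf x||f|}f(\mathbf x\cdot z)$. For homogeneous $x_j\in\mathfrak b$ ($j\neq i$) and $f\in\mathfrak b^*$ in the $i$-th place put $$[x_1,\dots,f,\dots,x_n]=(-1)^{n-i}(-1)^{|f|(|x_{i+1}|+\cdots+|x_n|)}\,\mathrm{ad}^*(x_1,\dots,\widehat{x_i},\dots,x_n)f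 .$$ Let $\theta:\mathfrak b^{n}\to\mathfrak b^*$ be an $n$-linear map of degree $0$ with the same super-skew-symmetry as the bracket, which is a $1$-supercocycle, i.e. for all homogeneous $\mathbf x,\mathbf y\in\mathfrak b^{n-1}$ and $z=y_n\in\mathfrak b$, $$\theta(\mathbf x,\mathbf y\cdot z)+\mathrm{ad}^*(\mathbf x)\theta(\mathbf y,z)=\sum_{i=1}^n(-1)^{|\mathbf x|(|y_1|+\cdots+|y_{i-1}|)}\Big(\theta(y_1,\dots,\mathbf x\cdot y_i,\dots,y_n)+[y_1,\dots,\theta(\mathbf x,y_i),\dots,y_n]\Big),$$ and which satisfies $\theta(\mathbf x,y)(z)+(-1)^{|y||z|}\theta(\mathbf x,z)(y)=0$. The *$T^*$-extension* $T^*_\theta\mathfrak b$ is the graded space $\mathfrak b\oplus\mathfrak b^*$ with, for homogeneous $x_i+f_i$, $x+f$, $y+g$ (so $|x_i|=|f_i|$, etc.), the bracket and form $$[x_1+f_1,\dots,x_n+f_n]_\theta=[x_1,\dots,x_n]+\theta(x_1,\dots,x_n)+\sum_{i=1}^n[x_1,\dots,f_i,\dots,x_n],\qquad \langle x+f,y+g\rangle_\theta=f(y)+(-1)^{|x||y|}g(x).$$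 **Theorem.** Let $(\mathfrak g,\langle\,,\rangle)$ be a finite-dimensional metric first-class $n$-Lie superalgebra over $\mathbb K$ which is nilpotent of length $k$. Then there exist a first-class $n$-Lie superalgebra $\mathfrak b$ over $\mathbb K$, nilpotent of length at most $\left[\frac{k+1}{2}\right]$, and a $1$-supercocycle $\theta$ of $\mathfrak b$ as above, such that $T^*_\theta\mathfrak b$ is a metric first-class $n$-Lie superalgebra and $\mathfrak g$ is isometric either to $T^*_\theta\mathfrak b$, or to a graded ideal of codimension $1$ of $T^*_\theta\mathfrak b$ on which $\langle\,,\rangle_\theta$ is nondegenerate. -/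

import Mathlib

universe u v

noncomputable section

namespace NLieSuper

open Module

/-- The sign `(-1)^a` for a degree `a` in `ℤ/2`. -/
def sgn (K : Type*) [Ring K] (a : ZMod 2) : K := if a = 0 then 1 else -1

/-- A `ℤ/2`-graded vector space `V = V₀ ⊕ V₁` over `K` with an `(m+1)`-ary multilinear bracket
of parity `0` (no symmetry and no identity is imposed yet). The arity is `n = m + 1`. -/
structure NSuperalgebra (K : Type*) [Field K] (m : ℕ) (V : Type*) [AddCommGroup V]
    [Module K V] where
  /-- the homogeneous components -/
  grading : ZMod 2 → Submodule K V
  isCompl_zero_one : IsCompl (grading 0) (grading 1)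
  /-- the `(m+1)`-ary bracket -/
  bracket : MultilinearMap K (fun _ : Fin (m + 1) => V) V
  bracket_mem : ∀ (d : Fin (m + 1) → ZMod 2) (x : Fin (m + 1) → V),
    (∀ i, x i ∈ grading (d i)) → bracket x ∈ grading (∑ i, d i)

/-- Super-skew-symmetry of a multilinear map on a graded space: exchanging the neighbouring
homogeneous arguments `x i` and `x (i+1)` gives the factor `-(-1)^{|x i| |x (i+1)|}`. -/
def IsSuperSkew {K : Type*} [Field K] {m : ℕ} {V : Type*} [AddCommGroup V] [Module K V]
    {M : Type*} [AddCommGroup M] [Module K M] (grading : ZMod 2 → Submodule K V)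
    (f : MultilinearMap K (fun _ : Fin (m + 1) => V) M) : Prop :=
  ∀ (d : Fin (m + 1) → ZMod 2) (x : Fin (m + 1) → V), (∀ i, x i ∈ grading (d i)) →
    ∀ i : Fin m,
      f x = -(sgn K (d i.castSucc * d i.succ) • f (x ∘ Equiv.swap i.castSucc i.succ))

namespace NSuperalgebra

variable {K : Type*} [Field K] {m : ℕ} {V : Type*} [AddCommGroup V] [Module K V]

theorem isCompl (A : NSuperalgebra K m V) (a : ZMod 2) :
    IsCompl (A.grading a) (A.grading (a + 1)) := by
  fin_cases a
  · exact A.isCompl_zero_one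
  · exact A.isCompl_zero_one.symm

/-- The projection of `V = V₀ ⊕ V₁` onto the component of degree `a`. -/
def proj (A : NSuperalgebra K m V) (a : ZMod 2) : V →ₗ[K] V :=
  (A.grading a).projection (A.grading (a + 1)) (A.isCompl a)

theorem proj_mem (A : NSuperalgebra K m V) (a : ZMod 2) (x : V) : A.proj a x ∈ A.grading a :=
  Submodule.projection_apply_mem _ x

theorem proj_of_mem (A : NSuperalgebra K m V) {a : ZMod 2} {x : V} (hx : x ∈ A.grading a) :
    A.proj a x = x :=
  Submodule.projection_apply_of_mem_left _ hx

theorem proj_of_mem_ne (A : NSuperalgebra K m V) {a b : ZMod 2} {x : V} (hx : x ∈ A.grading b)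
    (h : b ≠ a) : A.proj a x = 0 := by
  apply Submodule.projection_apply_of_mem_right
  have hb : b = a + 1 := (by decide : ∀ a b : ZMod 2, b ≠ a → b = a + 1) a b h
  exact hb ▸ hx

theorem proj_add_proj (A : NSuperalgebra K m V) (a : ZMod 2) (x : V) :
    A.proj a x + A.proj (a + 1) x = x := by
  have h := Submodule.projection_add_projection_eq_self (A.isCompl a) x
  have e : a + 1 + 1 = a := (by decide : ∀ a : ZMod 2, a + 1 + 1 = a) a
  have h2 : A.proj (a + 1) x =
      (A.grading (a + 1)).projection (A.grading a) (A.isCompl a).symm x := by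
    unfold proj
    congr 2
    simp [e]
  rw [h2]
  exact h

/-- A first-class `(m+1)`-Lie superalgebra: the bracket is super-skew-symmetric and satisfies the
super Filippov identity. -/
structure IsFirstClass (A : NSuperalgebra K m V) : Prop where
  skew : IsSuperSkew A.grading A.bracket
  filippov : ∀ (a : Fin m → ZMod 2) (x : Fin m → V) (b : Fin (m + 1) → ZMod 2)
    (y : Fin (m + 1) → V), (∀ i, x i ∈ A.grading (a i)) → (∀ i, y i ∈ A.grading (b i)) →
    A.bracket (Fin.snoc x (A.bracket y)) =
      ∑ i : Fin (m + 1), sgn K ((∑ j, a j) * ∑ j with j < i, b j) •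
        A.bracket (Function.update y i (A.bracket (Fin.snoc x (y i))))

/-- The descending series `g⁰ = g`, `g^{k+1} = [g^k, g, …, g]` (linear span of the brackets). -/
def lowerSeries (A : NSuperalgebra K m V) : ℕ → Submodule K V
  | 0 => ⊤
  | k + 1 => Submodule.span K {v | ∃ x : Fin (m + 1) → V, x 0 ∈ lowerSeries A k ∧ A.bracket x = v}

/-- `g` is nilpotent of length `k`: `k` is the smallest natural number with `g^k = 0`. -/
def IsNilpotentOfLength (A : NSuperalgebra K m V) (k : ℕ) : Prop :=
  IsLeast {j | A.lowerSeries j = ⊥} k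

/-- `B` makes `A` a metric superalgebra: it is consistent, supersymmetric, invariant and
nondegenerate. -/
structure IsMetric (A : NSuperalgebra K m V) (B : LinearMap.BilinForm K V) : Prop where
  consistent : ∀ a b : ZMod 2, a ≠ b → ∀ x ∈ A.grading a, ∀ y ∈ A.grading b, B x y = 0
  supersymmetric : ∀ a b : ZMod 2, ∀ x ∈ A.grading a, ∀ y ∈ A.grading b,
    B x y = sgn K (a * b) * B y x
  invariant : ∀ (d : Fin m → ZMod 2) (x : Fin m → V) (b c : ZMod 2) (y z : V),
    (∀ i, x i ∈ A.grading (d i)) → y ∈ A.grading b → z ∈ A.grading c →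
    B (A.bracket (Fin.snoc x y)) z =
      -(sgn K ((∑ i, d i) * b) * B y (A.bracket (Fin.snoc x z)))
  nondegenerate : ∀ x, (∀ y, B x y = 0) → x = 0

/-- Isometry of superalgebras carrying bilinear forms: a linear bijection of degree `0` that
preserves the brackets and the forms. -/
def Isometric {W : Type*} [AddCommGroup W] [Module K W]
    (A : NSuperalgebra K m V) (B : LinearMap.BilinForm K V)
    (A' : NSuperalgebra K m W) (B' : LinearMap.BilinForm K W) : Prop :=
  ∃ φ : V ≃ₗ[K] W,
    (∀ a, ∀ x ∈ A.grading a, φ x ∈ A'.grading a) ∧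
    (∀ x : Fin (m + 1) → V, φ (A.bracket x) = A'.bracket (fun i => φ (x i))) ∧
    (∀ x y, B' (φ x) (φ y) = B x y)

/-! ### Graded ideals -/

/-- A graded ideal: a graded subspace `I` such that a bracket with an entry in `I` lies in `I`. -/
structure IsGradedIdeal (A : NSuperalgebra K m V) (I : Submodule K V) : Prop where
  graded : ∀ x ∈ I, ∀ a, A.proj a x ∈ I
  ideal : ∀ (x : Fin (m + 1) → V) (i : Fin (m + 1)), x i ∈ I → A.bracket x ∈ I

/-- A graded ideal with the induced grading and bracket. -/
def restrict (A : NSuperalgebra K m V) (I : Submodule K V) (hI : A.IsGradedIdeal I) :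
    NSuperalgebra K m I where
  grading a := (A.grading a).comap I.subtype
  isCompl_zero_one := by
    constructor
    · rw [Submodule.disjoint_def]
      intro x h0 h1
      exact Subtype.ext ((Submodule.disjoint_def.1 A.isCompl_zero_one.disjoint) x.1 h0 h1)
    · rw [codisjoint_iff, eq_top_iff]
      intro x _
      refine Submodule.mem_sup.2 ⟨⟨A.proj 0 x, hI.graded x x.2 0⟩, A.proj_mem 0 x,
        ⟨A.proj 1 x, hI.graded x x.2 1⟩, A.proj_mem 1 x, ?_⟩
      exact Subtype.ext (A.proj_add_proj 0 x.1)
  bracket := (A.bracket.compLinearMap fun _ => I.subtype).codRestrict I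
    fun x => hI.ideal _ 0 (x 0).2
  bracket_mem := fun d x hx => A.bracket_mem d (fun i => (x i : V)) hx

/-! ### The coadjoint representation and 1-supercocycles -/

/-- `ad (x₁ ∧ ⋯ ∧ x_m) z = [x₁, …, x_m, z]`. -/
def ad (A : NSuperalgebra K m V) (x : Fin m → V) : V →ₗ[K] V := A.bracket.curryRight x

theorem ad_apply (A : NSuperalgebra K m V) (x : Fin m → V) (z : V) :
    A.ad x z = A.bracket (Fin.snoc x z) := rfl

/-- The grading of the dual space: a functional has degree `a` if it vanishes on the homogeneous
component of the other degree. -/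
def dualGrading (A : NSuperalgebra K m V) (a : ZMod 2) : Submodule K (Dual K V) :=
  (A.grading (a + 1)).dualAnnihilator

/-- The coadjoint action `ad*(x) f = -(-1)^{|x| |f|} f ∘ ad x`, for `|x| = a` and `|f| = b`. -/
def coad (A : NSuperalgebra K m V) (a b : ZMod 2) (x : Fin m → V) (f : Dual K V) : Dual K V :=
  -(sgn K (a * b) • f ∘ₗ A.ad x)

/-- The element `[x₁, …, f, …, x_{m+1}]` of the dual, with the functional `f` at place `i`: in the
supersymmetric notation for the coadjoint module this is
`(-1)^{m-i} (-1)^{|f| (|x_{i+1}| + ⋯)} ad*(x₁, …, x̂ᵢ, …, x_{m+1}) f` (places counted from `0`).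
Here `d j` is the degree of `x j` for `j ≠ i`, and `d i` is the degree of `f`;
the entry `x i` is not used. -/
def coadAt (A : NSuperalgebra K m V) (d : Fin (m + 1) → ZMod 2) (i : Fin (m + 1))
    (x : Fin (m + 1) → V) (f : Dual K V) : Dual K V :=
  ((-1 : K) ^ (m - (i : ℕ)) * sgn K (d i * ∑ j with i < j, d j)) •
    A.coad (∑ j, i.removeNth d j) (d i) (i.removeNth x) f

/-- Super-skew-symmetric `(m+1)`-linear maps `g × ⋯ × g → g*` of degree `0`, that is, the
`1`-supercochains of degree `0` with values in the coadjoint module. -/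
structure OneCochain (A : NSuperalgebra K m V) where
  toFun : MultilinearMap K (fun _ : Fin (m + 1) => V) (Dual K V)
  degree_zero : ∀ (d : Fin (m + 1) → ZMod 2) (x : Fin (m + 1) → V),
    (∀ i, x i ∈ A.grading (d i)) → toFun x ∈ A.dualGrading (∑ i, d i)
  skew : IsSuperSkew A.grading toFun

/-- The coboundary `(δθ)(x, y, z)` of a `1`-supercochain of degree `0`, on homogeneous arguments
`x = x₁ ∧ ⋯ ∧ x_m`, `y = y₁ ∧ ⋯ ∧ y_m`, `z` of degrees `a`, `b`, `c`:
`- θ(x·y, z) - (-1)^{|x||y|} θ(y, x·z) + θ(x, y·z)`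
`+ x·θ(y, z) - (-1)^{|x||y|} y·θ(x, z) - (θ(x, -)·y)·z`. -/
def coboundary (A : NSuperalgebra K m V) (θ : A.OneCochain) (a : Fin m → ZMod 2)
    (x : Fin m → V) (b : Fin m → ZMod 2) (y : Fin m → V) (c : ZMod 2) (z : V) : Dual K V :=
  -(∑ i : Fin m, sgn K ((∑ j, a j) * ∑ j with j < i, b j) •
      θ.toFun (Fin.snoc (Function.update y i (A.ad x (y i))) z))
  - sgn K ((∑ j, a j) * ∑ j, b j) • θ.toFun (Fin.snoc y (A.ad x z))
  + θ.toFun (Fin.snoc x (A.ad y z))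
  + A.coad (∑ j, a j) ((∑ j, b j) + c) x (θ.toFun (Fin.snoc y z))
  - sgn K ((∑ j, a j) * ∑ j, b j) •
      A.coad (∑ j, b j) ((∑ j, a j) + c) y (θ.toFun (Fin.snoc x z))
  - ∑ i : Fin m, sgn K ((∑ j, a j) * ∑ j with j < i, b j) •
      A.coadAt (Fin.snoc (Function.update b i ((∑ j, a j) + b i)) c) i.castSucc
        (Fin.snoc y z) (θ.toFun (Fin.snoc x (y i)))

/-- `δθ = 0`, i.e. `θ` is a `1`-supercocycle (of degree `0`). -/
def IsCocycle (A : NSuperalgebra K m V) (θ : A.OneCochain) : Prop :=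
  ∀ (a : Fin m → ZMod 2) (x : Fin m → V) (b : Fin m → ZMod 2) (y : Fin m → V) (c : ZMod 2) (z : V),
    (∀ i, x i ∈ A.grading (a i)) → (∀ i, y i ∈ A.grading (b i)) → z ∈ A.grading c →
    A.coboundary θ a x b y c z = 0

/-- The supercyclicity condition `θ(x, y)(z) + (-1)^{|y||z|} θ(x, z)(y) = 0`. -/
def IsSupercyclic (A : NSuperalgebra K m V) (θ : A.OneCochain) : Prop :=
  ∀ (d : Fin m → ZMod 2) (x : Fin m → V) (b c : ZMod 2) (y z : V),
    (∀ i, x i ∈ A.grading (d i)) → y ∈ A.grading b → z ∈ A.grading c →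
    θ.toFun (Fin.snoc x y) z + sgn K (b * c) * θ.toFun (Fin.snoc x z) y = 0

/-! ### The `T*`-extension -/

/-- The component of degree `a` of an element `x + f` of `g ⊕ g*`. -/
def tProj (A : NSuperalgebra K m V) (a : ZMod 2) : V × Dual K V →ₗ[K] V × Dual K V :=
  (A.proj a).prodMap (A.proj a).dualMap

/-- The formula
`[x₁, …, x_{m+1}] + θ(x₁, …, x_{m+1}) + ∑ᵢ [x₁, …, fᵢ, …, x_{m+1}]`
for the bracket of homogeneous elements `xᵢ + fᵢ` of `g ⊕ g*` of degrees `d i`. -/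
def tBracketHom (A : NSuperalgebra K m V) (θ : A.OneCochain) (d : Fin (m + 1) → ZMod 2)
    (X : Fin (m + 1) → V × Dual K V) : V × Dual K V :=
  (A.bracket (fun i => (X i).1),
    θ.toFun (fun i => (X i).1) + ∑ i, A.coadAt d i (fun j => (X j).1) (X i).2)

theorem coadAt_update_self (A : NSuperalgebra K m V) (d : Fin (m + 1) → ZMod 2) (i : Fin (m + 1))
    (x : Fin (m + 1) → V) (v : V) (f : Dual K V) :
    A.coadAt d i (Function.update x i v) f = A.coadAt d i x f := by
  simp [coadAt]

theorem coadAt_add (A : NSuperalgebra K m V) (d : Fin (m + 1) → ZMod 2) (i : Fin (m + 1))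
    (x : Fin (m + 1) → V) (f g : Dual K V) :
    A.coadAt d i x (f + g) = A.coadAt d i x f + A.coadAt d i x g := by
  ext z
  simp [coadAt, coad]
  ring

theorem coadAt_smul (A : NSuperalgebra K m V) (d : Fin (m + 1) → ZMod 2) (i : Fin (m + 1))
    (x : Fin (m + 1) → V) (c : K) (f : Dual K V) :
    A.coadAt d i x (c • f) = c • A.coadAt d i x f := by
  ext z
  simp [coadAt, coad]
  ring

theorem coadAt_update_add (A : NSuperalgebra K m V) (d : Fin (m + 1) → ZMod 2)
    {i j : Fin (m + 1)} (h : j ≠ i) (x : Fin (m + 1) → V) (u v : V) (f : Dual K V) :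
    A.coadAt d i (Function.update x j (u + v)) f =
      A.coadAt d i (Function.update x j u) f + A.coadAt d i (Function.update x j v) f := by
  obtain ⟨k, rfl⟩ := Fin.exists_succAbove_eq h
  ext z
  simp [coadAt, coad, ad, Fin.removeNth_update_succAbove]
  ring

theorem coadAt_update_smul (A : NSuperalgebra K m V) (d : Fin (m + 1) → ZMod 2)
    {i j : Fin (m + 1)} (h : j ≠ i) (x : Fin (m + 1) → V) (c : K) (u : V) (f : Dual K V) :
    A.coadAt d i (Function.update x j (c • u)) f =
      c • A.coadAt d i (Function.update x j u) f := by
  obtain ⟨k, rfl⟩ := Fin.exists_succAbove_eq h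
  ext z
  simp [coadAt, coad, ad, Fin.removeNth_update_succAbove]
  ring

/-- For fixed degrees the formula is multilinear. -/
def tBracketHomMulti (A : NSuperalgebra K m V) (θ : A.OneCochain) (d : Fin (m + 1) → ZMod 2) :
    MultilinearMap K (fun _ : Fin (m + 1) => V × Dual K V) (V × Dual K V) :=
  MultilinearMap.mk' (A.tBracketHom θ d)
    (by
      intro X j u v
      have key : ∀ w : V × Dual K V, (fun i => (Function.update X j w i).1) =
          Function.update (fun i => (X i).1) j w.1 := by
        intro w; ext i; rcases eq_or_ne i j with rfl | h <;> simp [*]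
      have hs : ∀ i, A.coadAt d i (Function.update (fun i => (X i).1) j (u + v).1)
            (Function.update X j (u + v) i).2 =
          A.coadAt d i (Function.update (fun i => (X i).1) j u.1) (Function.update X j u i).2 +
          A.coadAt d i (Function.update (fun i => (X i).1) j v.1) (Function.update X j v i).2 := by
        intro i
        rcases eq_or_ne j i with rfl | h
        · simp [coadAt_update_self, coadAt_add]
        · simp [Function.update_of_ne h.symm, coadAt_update_add A d h]
      simp only [tBracketHom, key, hs, Finset.sum_add_distrib]
      ext1
      · simp
      · simp only [Prod.fst_add, MultilinearMap.map_update_add, Prod.snd_add]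
        abel)
    (by
      intro X j c u
      have key : ∀ w : V × Dual K V, (fun i => (Function.update X j w i).1) =
          Function.update (fun i => (X i).1) j w.1 := by
        intro w; ext i; rcases eq_or_ne i j with rfl | h <;> simp [*]
      have hs : ∀ i, A.coadAt d i (Function.update (fun i => (X i).1) j (c • u).1)
            (Function.update X j (c • u) i).2 =
          c • A.coadAt d i (Function.update (fun i => (X i).1) j u.1)
            (Function.update X j u i).2 := by
        intro i
        rcases eq_or_ne j i with rfl | h
        · simp [coadAt_update_self, coadAt_smul]
        · simp [Function.update_of_ne h.symm, coadAt_update_smul A d h]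
      simp only [tBracketHom, key, hs, ← Finset.smul_sum]
      ext1
      · simp
      · simp only [Prod.smul_fst, MultilinearMap.map_update_smul, Prod.smul_snd, smul_add])

/-- The bracket of `g ⊕ g*`: the multilinear extension of the formula on homogeneous elements. -/
def tBracket (A : NSuperalgebra K m V) (θ : A.OneCochain) :
    MultilinearMap K (fun _ : Fin (m + 1) => V × Dual K V) (V × Dual K V) :=
  ∑ d : Fin (m + 1) → ZMod 2, (A.tBracketHomMulti θ d).compLinearMap fun i => A.tProj (d i)

/-- The grading `(g ⊕ g*)_a = g_a ⊕ (g*)_a`. -/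
def tGrading (A : NSuperalgebra K m V) (a : ZMod 2) : Submodule K (V × Dual K V) :=
  (A.grading a).prod (A.dualGrading a)

theorem tProj_of_mem (A : NSuperalgebra K m V) {a : ZMod 2} {X : V × Dual K V}
    (hX : X ∈ A.tGrading a) : A.tProj a X = X := by
  obtain ⟨x, f⟩ := X
  obtain ⟨hx, hf⟩ := hX
  refine Prod.ext (A.proj_of_mem hx) ?_
  ext z
  have h1 : f (A.proj (a + 1) z) = 0 :=
    (Submodule.mem_dualAnnihilator f).1 hf _ (A.proj_mem (a + 1) z)
  have h2 := congrArg f (A.proj_add_proj a z)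
  rw [map_add, h1, add_zero] at h2
  exact h2

theorem tProj_of_mem_ne (A : NSuperalgebra K m V) {a b : ZMod 2} {X : V × Dual K V}
    (hX : X ∈ A.tGrading b) (h : b ≠ a) : A.tProj a X = 0 := by
  obtain ⟨x, f⟩ := X
  obtain ⟨hx, hf⟩ := hX
  refine Prod.ext (A.proj_of_mem_ne hx h) ?_
  ext z
  have hb : a = b + 1 := (by decide : ∀ a b : ZMod 2, b ≠ a → a = b + 1) a b h
  subst hb
  exact (Submodule.mem_dualAnnihilator f).1 hf _ (A.proj_mem (b + 1) z)

/-- On homogeneous elements the bracket is given by the formula. -/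
theorem tBracket_apply (A : NSuperalgebra K m V) (θ : A.OneCochain) (d : Fin (m + 1) → ZMod 2)
    (X : Fin (m + 1) → V × Dual K V) (hX : ∀ i, X i ∈ A.tGrading (d i)) :
    A.tBracket θ X = A.tBracketHom θ d X := by
  rw [tBracket, sum_apply, Finset.sum_eq_single d]
  · rw [MultilinearMap.compLinearMap_apply]
    have : (fun i => A.tProj (d i) (X i)) = X := funext fun i => A.tProj_of_mem (hX i)
    rw [this]
    rfl
  · intro e _ he
    obtain ⟨i, hi⟩ := Function.ne_iff.1 he
    rw [MultilinearMap.compLinearMap_apply]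
    exact MultilinearMap.map_coord_zero _ i (A.tProj_of_mem_ne (hX i) hi.symm)
  · simp

theorem coadAt_mem (A : NSuperalgebra K m V) (d : Fin (m + 1) → ZMod 2) (i : Fin (m + 1))
    (x : Fin (m + 1) → V) (f : Dual K V) (hx : ∀ j, x j ∈ A.grading (d j))
    (hf : f ∈ A.dualGrading (d i)) : A.coadAt d i x f ∈ A.dualGrading (∑ j, d j) := by
  refine Submodule.smul_mem _ _ (Submodule.neg_mem _ (Submodule.smul_mem _ _ ?_))
  refine (Submodule.mem_dualAnnihilator _).2 fun z hz => ?_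
  refine (Submodule.mem_dualAnnihilator f).1 hf _ ?_
  have h := A.bracket_mem (Fin.snoc (i.removeNth d) ((∑ j, d j) + 1)) (Fin.snoc (i.removeNth x) z)
    (by
      intro j
      refine Fin.lastCases ?_ (fun k => ?_) j
      · simpa using hz
      · simpa [Fin.removeNth] using hx _)
  rw [Fin.sum_snoc, Fin.sum_univ_succAbove d i] at h
  have e : ∀ s t : ZMod 2, s + (t + s + 1) = t + 1 := by decide
  have e2 : ∑ j, i.removeNth d j = ∑ j, d (i.succAbove j) := rfl
  rw [e2, e] at h
  exact h

/-- The superalgebra `g ⊕ g*` with the bracket defined by `θ`. -/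
def tStar (A : NSuperalgebra K m V) (θ : A.OneCochain) : NSuperalgebra K m (V × Dual K V) where
  grading := A.tGrading
  isCompl_zero_one := by
    have h1 := A.isCompl_zero_one
    have h2 : IsCompl (A.dualGrading 0) (A.dualGrading 1) :=
      Subspace.isCompl_dualAnnihilator h1.symm
    constructor
    · rw [Submodule.disjoint_def]
      rintro ⟨x, f⟩ hx hy
      exact Prod.ext (Submodule.disjoint_def.1 h1.disjoint x hx.1 hy.1)
        (Submodule.disjoint_def.1 h2.disjoint f hx.2 hy.2)
    · rw [codisjoint_iff]
      unfold tGrading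
      rw [Submodule.prod_sup_prod, codisjoint_iff.1 h1.codisjoint, codisjoint_iff.1 h2.codisjoint,
        Submodule.prod_top]
  bracket := A.tBracket θ
  bracket_mem := by
    intro d X hX
    rw [A.tBracket_apply θ d X hX]
    refine ⟨A.bracket_mem d _ fun i => (hX i).1, ?_⟩
    refine Submodule.add_mem _ (θ.degree_zero d _ fun i => (hX i).1) ?_
    exact Submodule.sum_mem _ fun i _ => A.coadAt_mem d i _ _ (fun j => (hX j).1) (hX i).2

/-- The bilinear form on `g ⊕ g*` given by `⟨x + f, y + g⟩ = f(y) + (-1)^{|x||y|} g(x)` on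
homogeneous elements, `|x + f| = |x|`, `|y + g| = |y|`. -/
def tForm (A : NSuperalgebra K m V) : LinearMap.BilinForm K (V × Dual K V) :=
  ∑ a : ZMod 2, ∑ b : ZMod 2,
    (LinearMap.mk₂ K (fun X Y : V × Dual K V => X.2 Y.1 + sgn K (a * b) * Y.2 X.1)
      (by intro X X' Y; simp; ring) (by intro c X Y; simp; ring)
      (by intro X Y Y'; simp; ring) (by intro c X Y; simp; ring)).compl₁₂ (A.tProj a) (A.tProj b)

/-- On homogeneous elements the form is given by the formula. -/
theorem tForm_apply (A : NSuperalgebra K m V) (a b : ZMod 2) (X Y : V × Dual K V)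
    (hX : X ∈ A.tGrading a) (hY : Y ∈ A.tGrading b) :
    A.tForm X Y = X.2 Y.1 + sgn K (a * b) * Y.2 X.1 := by
  unfold tForm
  simp only [LinearMap.sum_apply, LinearMap.compl₁₂_apply]
  rw [Finset.sum_eq_single a, Finset.sum_eq_single b]
  · rw [A.tProj_of_mem hX, A.tProj_of_mem hY]; rfl
  · intro c _ hc
    rw [A.tProj_of_mem_ne hY hc.symm]; exact map_zero _
  · simp
  · intro c _ hc
    rw [A.tProj_of_mem_ne hX hc.symm]
    exact Finset.sum_eq_zero fun e _ => by rw [map_zero]; rfl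
  · simp

/-- `θ` defines a `T*`-extension of `A`: it is a `1`-supercocycle satisfying the supercyclicity
condition. The `T*`-extension is then `A.tStar θ` with the bilinear form `A.tForm`. -/
structure DefinesTStarExtension (A : NSuperalgebra K m V) (θ : A.OneCochain) : Prop where
  cocycle : A.IsCocycle θ
  supercyclic : A.IsSupercyclic θ

end NSuperalgebra

end NLieSuper

end

/-! Let `I` be a graded ideal equal to its own orthogonal. The form identifies `I` with the dual of
the quotient by `I`, and, 2 being invertible, `I` has a graded isotropic complement, the image of a
section `s` of the projection `p` (`IsMetric.exists_lagrangianSplitting`). Put `θ(w₁, …)(w) = ⟨[s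
w₁, …], s w⟩` and expand a bracket along this splitting: terms with two entries in `I` vanish, and
terms with one such entry are coadjoint terms by invariance (`form_bracket_section`). Hence `x ↦ (p
x, ⟨x, s ·⟩)` is an isometry onto the `T*`-extension. The Filippov identity and the metric axioms of
the extension are transported along it, and the cocycle condition is read off from the transported
identity (`isCocycle_of_isFirstClass`).

It remains to find `I`. Since `g^i` is orthogonal to `g^j` for `i + j ≥ k`, the ideal `g^[(k+1)/2]`
is isotropic; take a maximal isotropic graded ideal `I` above it. This containment gives the bound
on the length of the quotient. By nilpotency, a graded ideal inside the orthogonal of `I` but not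
inside `I` contains a homogeneous vector outside `I` that is central modulo `I`. Maximality makes
such a vector anisotropic, hence even, and two orthogonal ones would combine, using a square root of
-1, into an isotropic one. So `I` is its own orthogonal, or the orthogonal is `I ⊕ Kv` with `⟨v, v⟩
= 1` (`IsMetric.exists_maximal_isotropic`).

In the second case add an even central line `Ke` with `⟨e, e⟩ = -1`. Then `I + K(v + e)` is its own
orthogonal in the sum, and the original algebra is a nondegenerate ideal of codimension one there.
-/

noncomputable section

namespace NLieSuper

open Module

/-! ### Signs, and moving an entry of a super-skew map to the last place -/

section Sign

variable {K : Type*} [Ring K]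

theorem sgn_zero : sgn K 0 = 1 := rfl

theorem sgn_one : sgn K 1 = -1 := if_neg (by decide)

theorem sgn_eq_or (a : ZMod 2) : sgn K a = 1 ∨ sgn K a = -1 := by
  unfold sgn; split <;> simp

theorem sgn_mul_self (a : ZMod 2) : sgn K a * sgn K a = 1 := by
  rcases sgn_eq_or (K := K) a with h | h <;> simp [h]

theorem sgn_add (a b : ZMod 2) : sgn K (a + b) = sgn K a * sgn K b := by
  have h : ∀ a b : ZMod 2, (a = 0 ∧ b = 0 ∧ a + b = 0) ∨ (a = 0 ∧ b = 1 ∧ a + b = 1) ∨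
      (a = 1 ∧ b = 0 ∧ a + b = 1) ∨ (a = 1 ∧ b = 1 ∧ a + b = 0) := by decide
  rcases h a b with ⟨h1, h2, h3⟩ | ⟨h1, h2, h3⟩ | ⟨h1, h2, h3⟩ | ⟨h1, h2, h3⟩ <;>
    rw [h3, h1, h2] <;> simp [sgn_zero, sgn_one]

theorem neg_one_pow_mul_self (n : ℕ) : (-1 : K) ^ n * (-1) ^ n = 1 := by
  rcases neg_one_pow_eq_or K n with h | h <;> simp [h]

end Sign

/-- The sign picked up when the entry at place `i` is moved to the last place. -/
def moveSign (K : Type*) [Ring K] {m : ℕ} (d : Fin (m + 1) → ZMod 2) (i : Fin (m + 1)) : K :=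
  (-1 : K) ^ (m - (i : ℕ)) * sgn K (d i * ∑ j with i < j, d j)

theorem moveSign_mul_self {K : Type*} [Field K] {m : ℕ} (d : Fin (m + 1) → ZMod 2)
    (i : Fin (m + 1)) : moveSign K d i * moveSign K d i = 1 := by
  unfold moveSign
  rw [mul_mul_mul_comm, neg_one_pow_mul_self, sgn_mul_self, one_mul]

theorem removeNth_succ_comp_swap {α : Type*} {m : ℕ} (i : Fin m) (x : Fin (m + 1) → α) :
    i.succ.removeNth (x ∘ Equiv.swap i.castSucc i.succ) = i.castSucc.removeNth x := by
  funext j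
  simp only [Fin.removeNth, Function.comp]
  rcases lt_trichotomy j i with h | rfl | h
  · have h' : (j : ℕ) < i := h
    rw [Fin.succAbove_of_castSucc_lt _ _ (show (j : ℕ) < (i : ℕ) + 1 by omega),
      Fin.succAbove_of_castSucc_lt _ _ (show (j : ℕ) < (i : ℕ) by omega),
      Equiv.swap_apply_of_ne_of_ne (Fin.ne_of_val_ne _) (Fin.ne_of_val_ne _)] <;>
      simp only [Fin.val_castSucc, Fin.val_succ, ne_eq] <;> omega
  · rw [Fin.succAbove_of_castSucc_lt _ _ (show (j : ℕ) < (j : ℕ) + 1 by omega),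
      Fin.succAbove_of_le_castSucc _ _ le_rfl, Equiv.swap_apply_left]
  · have h' : (i : ℕ) < j := h
    rw [Fin.succAbove_of_le_castSucc _ _ (show (i : ℕ) + 1 ≤ (j : ℕ) by omega),
      Fin.succAbove_of_le_castSucc _ _ (show (i : ℕ) ≤ (j : ℕ) by omega),
      Equiv.swap_apply_of_ne_of_ne (Fin.ne_of_val_ne _) (Fin.ne_of_val_ne _)] <;>
      simp only [Fin.val_succ, Fin.val_castSucc, ne_eq] <;> omega

theorem sum_lt_comp_swap {m : ℕ} (i : Fin m) (d : Fin (m + 1) → ZMod 2) :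
    ∑ j with i.castSucc < j, d j =
      d i.succ + ∑ j with i.succ < j, (d ∘ Equiv.swap i.castSucc i.succ) j := by
  have h : Finset.univ.filter (fun j => i.castSucc < j) =
      insert i.succ (Finset.univ.filter fun j => i.succ < j) := by
    ext j; simp [Fin.lt_def, Fin.ext_iff]; omega
  rw [h, Finset.sum_insert (by simp)]
  congr 1
  refine Finset.sum_congr rfl fun j hj => ?_
  rw [Finset.mem_filter] at hj
  rw [Function.comp, Equiv.swap_apply_of_ne_of_ne] <;>
    simp [Fin.ext_iff, Fin.lt_def] at * <;> omega

/-- One neighbouring exchange contributes a minus sign and one Koszul sign; this is the recursion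
that drives `IsSuperSkew.move_last`. -/
theorem moveSign_castSucc {K : Type*} [Field K] {m : ℕ} (d : Fin (m + 1) → ZMod 2) (i : Fin m) :
    moveSign K d i.castSucc = -(sgn K (d i.castSucc * d i.succ) *
      moveSign K (d ∘ Equiv.swap i.castSucc i.succ) i.succ) := by
  unfold moveSign
  rw [sum_lt_comp_swap, mul_add, sgn_add]
  have h : m - (i.castSucc : ℕ) = (m - (i.succ : ℕ)) + 1 := by
    simp; omega
  rw [h, pow_succ, Function.comp_apply, Equiv.swap_apply_right]
  ring

/-- Moving the entry at place `i` of a super-skew-symmetric map to the last place. -/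
theorem IsSuperSkew.move_last {K : Type*} [Field K] {m : ℕ} {V : Type*} [AddCommGroup V]
    [Module K V] {M : Type*} [AddCommGroup M] [Module K M] {grading : ZMod 2 → Submodule K V}
    {f : MultilinearMap K (fun _ : Fin (m + 1) => V) M} (hf : IsSuperSkew grading f)
    (i : Fin (m + 1)) : ∀ (d : Fin (m + 1) → ZMod 2) (x : Fin (m + 1) → V),
    (∀ i, x i ∈ grading (d i)) →
    f x = moveSign K d i • f (Fin.snoc (i.removeNth x) (x i)) := by
  induction i using Fin.reverseInduction with
  | last =>
    intro d x _
    have h : (Finset.univ.filter fun j => Fin.last m < j) = ∅ := by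
      ext j; simp [Fin.le_last]
    have hx : Fin.snoc ((Fin.last m).removeNth x) (x (Fin.last m)) = x := by
      rw [Fin.removeNth_last, Fin.snoc_init_self]
    rw [hx, moveSign, h]
    simp [sgn_zero]
  | cast i ih =>
    intro d x hx
    -- Downward induction on the place: one exchange carries the entry one place to the right and
    -- keeps the order of the others.
    rw [hf d x hx i, ih (d ∘ Equiv.swap i.castSucc i.succ) (x ∘ Equiv.swap i.castSucc i.succ)
      (fun j => hx _), removeNth_succ_comp_swap, moveSign_castSucc, Function.comp_apply,
      Equiv.swap_apply_right, smul_smul, neg_smul]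

/-! ### Homogeneous components and graded ideals -/

namespace NSuperalgebra

variable {K : Type*} [Field K] {m : ℕ} {V : Type*} [AddCommGroup V] [Module K V]

theorem sum_proj (A : NSuperalgebra K m V) (x : V) : ∑ a : ZMod 2, A.proj a x = x := by
  have := A.proj_add_proj 0 x
  rw [zero_add] at this
  exact (Fin.sum_univ_two (fun a : ZMod 2 => A.proj a x)).trans this

theorem proj_of_homogeneous (A : NSuperalgebra K m V) {b : ZMod 2} {x : V}
    (hx : x ∈ A.grading b) (a : ZMod 2) : A.proj a x = if b = a then x else 0 := by
  split_ifs with h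
  · exact A.proj_of_mem (h ▸ hx)
  · exact A.proj_of_mem_ne hx h

/-- A graded subspace: it contains the homogeneous components of its elements. -/
def IsGraded (A : NSuperalgebra K m V) (J : Submodule K V) : Prop :=
  ∀ x ∈ J, ∀ a, A.proj a x ∈ J

theorem isGraded_top (A : NSuperalgebra K m V) : A.IsGraded ⊤ := fun _ _ _ => trivial

theorem IsGraded.sup_span {A : NSuperalgebra K m V} {J : Submodule K V} (h : A.IsGraded J)
    {v : V} {b : ZMod 2} (hv : v ∈ A.grading b) : A.IsGraded (J ⊔ K ∙ v) := by
  intro x hx a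
  obtain ⟨y, hy, z, hz, rfl⟩ := Submodule.mem_sup.1 hx
  obtain ⟨c, rfl⟩ := Submodule.mem_span_singleton.1 hz
  rw [map_add, map_smul, A.proj_of_homogeneous hv]
  refine Submodule.add_mem_sup (h y hy a) (Submodule.smul_mem _ _ ?_)
  split_ifs
  · exact Submodule.mem_span_singleton_self v
  · exact zero_mem _

theorem IsGradedIdeal.isGraded {A : NSuperalgebra K m V} {I : Submodule K V}
    (h : A.IsGradedIdeal I) : A.IsGraded I := h.graded

section Multilinear

variable {M : Type*} [AddCommGroup M] [Module K M]

theorem map_eq_sum_proj (A : NSuperalgebra K m V) {n : ℕ}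
    (f : MultilinearMap K (fun _ : Fin n => V) M) (x : Fin n → V) :
    f x = ∑ d : Fin n → ZMod 2, f (fun i => A.proj (d i) (x i)) := by
  rw [← f.map_sum (fun i a => A.proj a (x i))]
  simp only [sum_proj]

/-- The sign rules are available only for homogeneous arguments. Multilinearity reduces to these,
and gradedness of `J` keeps the distinguished entry in `J`. -/
theorem map_mem_of_homogeneous (A : NSuperalgebra K m V) {n : ℕ}
    (f : MultilinearMap K (fun _ : Fin n => V) M) {J : Submodule K V} (hJ : A.IsGraded J)
    (N : Submodule K M) (i : Fin n)
    (h : ∀ (d : Fin n → ZMod 2) (y : Fin n → V), (∀ j, y j ∈ A.grading (d j)) → y i ∈ J →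
      f y ∈ N) (x : Fin n → V) (hx : x i ∈ J) : f x ∈ N := by
  rw [A.map_eq_sum_proj f x]
  exact Submodule.sum_mem _ fun d _ => h d _ (fun j => A.proj_mem _ _) (hJ _ hx _)

theorem map_eq_of_homogeneous (A : NSuperalgebra K m V) {n : ℕ}
    (f g : MultilinearMap K (fun _ : Fin n => V) M)
    (h : ∀ (d : Fin n → ZMod 2) (y : Fin n → V), (∀ j, y j ∈ A.grading (d j)) → f y = g y)
    (x : Fin n → V) : f x = g x := by
  rw [A.map_eq_sum_proj f x, A.map_eq_sum_proj g x]
  exact Finset.sum_congr rfl fun d _ => h d _ fun j => A.proj_mem _ _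

end Multilinear

/-- Brackets with the distinguished entry at `i` or at `i₀` become, up to sign, the same bracket
once that entry is moved last. This frees the descending series from the place `0` used in its
definition. -/
theorem mem_of_place (A : NSuperalgebra K m V) (hA : IsSuperSkew A.grading A.bracket)
    {J : Submodule K V} (hJ : A.IsGraded J) {N : Submodule K V} (i₀ : Fin (m + 1))
    (h : ∀ x : Fin (m + 1) → V, x i₀ ∈ J → A.bracket x ∈ N) (i : Fin (m + 1))
    (x : Fin (m + 1) → V) (hx : x i ∈ J) : A.bracket x ∈ N := by
  refine A.map_mem_of_homogeneous A.bracket hJ N i (fun d y hy hyi => ?_) x hx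
  have h1 := hA.move_last i d y hy
  have h2 := hA.move_last i₀ (i₀.insertNth (d i) (i.removeNth d))
    (i₀.insertNth (y i) (i.removeNth y)) (fun j => by
      rcases Fin.eq_self_or_eq_succAbove i₀ j with rfl | ⟨k, rfl⟩
      · simpa using hy i
      · simpa [Fin.removeNth] using hy _)
  have h3 := h (i₀.insertNth (y i) (i.removeNth y)) (by simpa using hyi)
  rw [Fin.removeNth_insertNth, Fin.insertNth_apply_same] at h2
  have h4 := congrArg (moveSign K (i₀.insertNth (d i) (i.removeNth d)) i₀ • ·) h2
  simp only [smul_smul, moveSign_mul_self, one_smul] at h4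
  rw [h1, ← h4]
  exact N.smul_mem _ (N.smul_mem _ h3)

theorem IsGradedIdeal.sup_span {A : NSuperalgebra K m V} {I : Submodule K V}
    (hI : A.IsGradedIdeal I) {v : V} {b : ZMod 2} (hv : v ∈ A.grading b)
    (h : ∀ (x : Fin (m + 1) → V) (i : Fin (m + 1)), x i = v → A.bracket x ∈ I) :
    A.IsGradedIdeal (I ⊔ K ∙ v) := by
  refine ⟨hI.isGraded.sup_span hv, fun x i hx => ?_⟩
  obtain ⟨y, hy, z, hz, hyz⟩ := Submodule.mem_sup.1 hx
  obtain ⟨c, rfl⟩ := Submodule.mem_span_singleton.1 hz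
  rw [← Function.update_eq_self i x, ← hyz, MultilinearMap.map_update_add,
    MultilinearMap.map_update_smul]
  exact Submodule.mem_sup_left (add_mem (hI.ideal _ i (by simpa using hy))
    (Submodule.smul_mem _ _ (h _ i (by simp))))

/-! ### The descending series -/

theorem isGraded_lowerSeries (A : NSuperalgebra K m V) : ∀ k, A.IsGraded (A.lowerSeries k)
  | 0 => A.isGraded_top
  | k + 1 => by
    intro x hx a
    have : A.lowerSeries (k + 1) ≤ (A.lowerSeries (k + 1)).comap (A.proj a) := by
      refine Submodule.span_le.2 ?_
      rintro _ ⟨x, hx, rfl⟩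
      refine A.map_mem_of_homogeneous ((A.proj a).compMultilinearMap A.bracket)
        (A.isGraded_lowerSeries k) (A.lowerSeries (k + 1)) 0 (fun d y hy hy0 => ?_) x hx
      rw [LinearMap.compMultilinearMap_apply, A.proj_of_homogeneous (A.bracket_mem d y hy)]
      split_ifs
      · exact Submodule.subset_span ⟨y, hy0, rfl⟩
      · exact zero_mem _
    exact this hx

theorem bracket_mem_lowerSeries {A : NSuperalgebra K m V} (hA : IsSuperSkew A.grading A.bracket)
    (k : ℕ) (x : Fin (m + 1) → V) (i : Fin (m + 1)) (hx : x i ∈ A.lowerSeries k) :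
    A.bracket x ∈ A.lowerSeries (k + 1) :=
  A.mem_of_place hA (A.isGraded_lowerSeries k) 0
    (N := A.lowerSeries (k + 1)) (fun y hy => Submodule.subset_span ⟨y, hy, rfl⟩) i x hx

theorem lowerSeries_succ_le (A : NSuperalgebra K m V) :
    ∀ k, A.lowerSeries (k + 1) ≤ A.lowerSeries k
  | 0 => le_top
  | k + 1 => Submodule.span_mono fun _ => fun ⟨x, hx, h⟩ => ⟨x, A.lowerSeries_succ_le k hx, h⟩

theorem lowerSeries_antitone (A : NSuperalgebra K m V) : Antitone A.lowerSeries :=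
  antitone_nat_of_succ_le A.lowerSeries_succ_le

theorem isGradedIdeal_lowerSeries {A : NSuperalgebra K m V}
    (hA : IsSuperSkew A.grading A.bracket) (k : ℕ) : A.IsGradedIdeal (A.lowerSeries k) :=
  ⟨A.isGraded_lowerSeries k, fun x i hx =>
    A.lowerSeries_succ_le k (bracket_mem_lowerSeries hA k x i hx)⟩

end NSuperalgebra

namespace NSuperalgebra

variable {K : Type*} [Field K] {m : ℕ} {V : Type*} [AddCommGroup V] [Module K V]

/-! ### Orthogonality in metric superalgebras -/

/-- The left orthogonal of a subspace with respect to a bilinear form. -/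
def orth (B : LinearMap.BilinForm K V) (J : Submodule K V) : Submodule K V :=
  J.dualAnnihilator.comap B

theorem mem_orth {B : LinearMap.BilinForm K V} {J : Submodule K V} {x : V} :
    x ∈ orth B J ↔ ∀ y ∈ J, B x y = 0 := by
  rw [orth, Submodule.mem_comap, Submodule.mem_dualAnnihilator]

section Metric

variable {A : NSuperalgebra K m V} {B : LinearMap.BilinForm K V}

theorem IsMetric.bijective [FiniteDimensional K V] (hB : A.IsMetric B) :
    Function.Bijective B := by
  have h : Function.Injective B := by
    rw [injective_iff_map_eq_zero]
    exact fun x hx => hB.nondegenerate x fun y => LinearMap.congr_fun hx y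
  exact ⟨h, (LinearMap.injective_iff_surjective_of_finrank_eq_finrank
    (Subspace.dual_finrank_eq (K := K) (V := V)).symm).1 h⟩

/-- Consistency kills the mixed terms, so the homogeneous projections are self-adjoint. -/
theorem IsMetric.form_proj (hB : A.IsMetric B) (a : ZMod 2) (x y : V) :
    B (A.proj a x) y = B x (A.proj a y) := by
  have h1 : B (A.proj a x) (A.proj (a + 1) y) = 0 :=
    hB.consistent a (a + 1) (by simp) _ (A.proj_mem _ _) _ (A.proj_mem _ _)
  have h2 : B (A.proj (a + 1) x) (A.proj a y) = 0 :=
    hB.consistent (a + 1) a (by simp) _ (A.proj_mem _ _) _ (A.proj_mem _ _)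
  conv_lhs => rw [← A.proj_add_proj a y, map_add, h1, add_zero]
  conv_rhs => rw [← A.proj_add_proj a x, map_add, LinearMap.add_apply, h2, add_zero]

theorem IsMetric.form_flip (hB : A.IsMetric B) (x y : V) :
    B y x = ∑ a : ZMod 2, sgn K (a * a) * B x (A.proj a y) := by
  conv_lhs => rw [← A.sum_proj y, map_sum, LinearMap.sum_apply]
  refine Finset.sum_congr rfl fun a _ => ?_
  have h : A.proj a (A.proj a y) = A.proj a y := A.proj_of_mem (A.proj_mem a y)
  rw [← h, hB.form_proj, h,
    hB.supersymmetric a a _ (A.proj_mem a y) _ (A.proj_mem a x), hB.form_proj, h]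

/-- For a graded subspace, left orthogonality implies right orthogonality, although the form is
symmetric only up to sign on components. -/
theorem IsMetric.form_flip_eq_zero (hB : A.IsMetric B) {J : Submodule K V} (hJ : A.IsGraded J)
    {x y : V} (hx : x ∈ orth B J) (hy : y ∈ J) : B y x = 0 := by
  rw [hB.form_flip]
  exact Finset.sum_eq_zero fun a _ => by rw [mem_orth.1 hx _ (hJ y hy a), mul_zero]

theorem IsMetric.isGraded_orth (hB : A.IsMetric B) {J : Submodule K V} (hJ : A.IsGraded J) :
    A.IsGraded (orth B J) := fun x hx a => mem_orth.2 fun y hy => by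
  rw [hB.form_proj]
  exact mem_orth.1 hx _ (hJ y hy a)

/-- Invariance of the form with respect to the entry at an arbitrary place. -/
theorem IsMetric.form_bracket (hA : IsSuperSkew A.grading A.bracket) (hB : A.IsMetric B)
    {d : Fin (m + 1) → ZMod 2} {x : Fin (m + 1) → V} (hx : ∀ j, x j ∈ A.grading (d j))
    (i : Fin (m + 1)) {c : ZMod 2} {z : V} (hz : z ∈ A.grading c) :
    B (A.bracket x) z = -(moveSign K d i * sgn K ((∑ j, i.removeNth d j) * d i) *
      B (x i) (A.bracket (Fin.snoc (i.removeNth x) z))) := by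
  rw [hA.move_last i d x hx, map_smul, LinearMap.smul_apply, smul_eq_mul,
    hB.invariant (i.removeNth d) (i.removeNth x) (d i) c (x i) z (fun j => hx _) (hx i) hz]
  ring

/-- Invariance moves the bracket to the other side, leaving `x i` alone on the left and `z` as last
entry on the right, up to sign and after passing to components. -/
theorem IsMetric.form_bracket_eq_zero (hA : IsSuperSkew A.grading A.bracket) (hB : A.IsMetric B)
    {J J' : Submodule K V} (hJ : A.IsGraded J) (hJ' : A.IsGraded J')
    (h : ∀ u ∈ J, ∀ y : Fin (m + 1) → V, y (Fin.last m) ∈ J' → B u (A.bracket y) = 0)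
    (x : Fin (m + 1) → V) (i : Fin (m + 1)) (hx : x i ∈ J) {z : V} (hz : z ∈ J') :
    B (A.bracket x) z = 0 := by
  rw [← A.sum_proj z, map_sum]
  refine Finset.sum_eq_zero fun c _ => ?_
  refine (Submodule.mem_bot K).1 (A.map_mem_of_homogeneous
    ((LinearMap.flip B (A.proj c z)).compMultilinearMap A.bracket) hJ ⊥ i (fun d y hy hyi => ?_) x hx)
  rw [Submodule.mem_bot, LinearMap.compMultilinearMap_apply, LinearMap.flip_apply,
    hB.form_bracket hA hy i (A.proj_mem c z), h _ hyi _ (by simpa using hJ' z hz c), mul_zero,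
    neg_zero]

theorem IsMetric.isGradedIdeal_orth (hA : IsSuperSkew A.grading A.bracket) (hB : A.IsMetric B)
    {J : Submodule K V} (hJ : A.IsGradedIdeal J) : A.IsGradedIdeal (orth B J) :=
  ⟨hB.isGraded_orth hJ.isGraded, fun x i hx => mem_orth.2 fun _ hz =>
    hB.form_bracket_eq_zero hA (hB.isGraded_orth hJ.isGraded) hJ.isGraded
      (fun _ hu y hy => mem_orth.1 hu _ (hJ.ideal y _ hy)) x i hx hz⟩

/-- The terms of the descending series are orthogonal to each other as soon as the sum of their
indices reaches the length of the series. -/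
theorem IsMetric.form_lowerSeries (hA : IsSuperSkew A.grading A.bracket) (hB : A.IsMetric B)
    {k : ℕ} (hk : A.lowerSeries k = ⊥) :
    ∀ i j, k ≤ i + j → A.lowerSeries i ≤ orth B (A.lowerSeries j)
  | 0, j, h => fun x _ => mem_orth.2 fun y hy => by
    have := A.lowerSeries_antitone (by simpa using h) hy
    rw [hk, Submodule.mem_bot] at this
    rw [this, map_zero]
  | i + 1, j, h => by
    refine Submodule.span_le.2 ?_
    rintro _ ⟨x, hx, rfl⟩
    refine mem_orth.2 fun z hz => ?_
    -- Moving one bracket across the form trades the indices `(i + 1, j)` for `(i, j + 1)`.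
    refine hB.form_bracket_eq_zero hA (A.isGraded_lowerSeries i) (A.isGraded_lowerSeries j)
      (fun u hu y hy => ?_) x 0 hx hz
    exact mem_orth.1 (hB.form_lowerSeries hA hk i (j + 1) (by omega) hu) _
      (bracket_mem_lowerSeries hA j y _ hy)

theorem IsMetric.form_self_of_odd (hchar : (2 : K) ≠ 0) (hB : A.IsMetric B) {v : V}
    (hv : v ∈ A.grading 1) : B v v = 0 := by
  have h := hB.supersymmetric 1 1 v hv v hv
  rw [one_mul, sgn_one, neg_one_mul] at h
  have : (2 : K) * B v v = 0 := by linear_combination h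
  exact (mul_eq_zero.1 this).resolve_left hchar

/-! ### Maximal isotropic ideals -/

/-- In a nilpotent superalgebra a graded ideal `J` not contained in the graded ideal `I` contains
a homogeneous element which is central modulo `I` and does not lie in `I`. -/
theorem exists_central_mod (hA : IsSuperSkew A.grading A.bracket) {k : ℕ}
    (hk : A.lowerSeries k = ⊥) {I J : Submodule K V} (hJ : A.IsGradedIdeal J) (hIJ : ¬ J ≤ I) :
    ∃ (a : ZMod 2) (v : V), v ∈ A.grading a ∧ v ∈ J ∧ v ∉ I ∧
      ∀ (x : Fin (m + 1) → V) (i : Fin (m + 1)), x i = v → A.bracket x ∈ I := by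
  classical
  -- Go to the last term of the series whose intersection with `J` is not inside `I`: a bracket with
  -- an element of this intersection lies in the next intersection, hence in `I`.
  have hex : ∃ i, J ⊓ A.lowerSeries i ≤ I := ⟨k, by simp [hk]⟩
  obtain ⟨i, hi⟩ : ∃ i, Nat.find hex = i + 1 := Nat.exists_eq_succ_of_ne_zero fun h0 => hIJ <| by
    have := Nat.find_spec hex
    rw [h0] at this
    exact (inf_top_eq J).symm.le.trans this
  have h1 : J ⊓ A.lowerSeries (i + 1) ≤ I := hi ▸ Nat.find_spec hex
  have h2 : ¬ J ⊓ A.lowerSeries i ≤ I := Nat.find_min hex (by omega)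
  obtain ⟨x, hx, hxI⟩ := SetLike.not_le_iff_exists.1 h2
  obtain ⟨a, ha⟩ : ∃ a, A.proj a x ∉ I := by
    by_contra! h
    exact hxI (A.sum_proj x ▸ Submodule.sum_mem _ fun a _ => h a)
  refine ⟨a, A.proj a x, A.proj_mem a x, hJ.graded x hx.1 a, ha, fun y j hy => h1 ⟨?_, ?_⟩⟩
  · exact hJ.ideal y j (hy ▸ hJ.graded x hx.1 a)
  · exact bracket_mem_lowerSeries hA i y j (hy ▸ A.isGraded_lowerSeries i x hx.2 a)

/-- A maximal isotropic graded ideal of a nilpotent metric superalgebra is either Lagrangian or of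
codimension one in its orthogonal. -/
theorem IsMetric.exists_maximal_isotropic [IsAlgClosed K] [FiniteDimensional K V]
    (hchar : (2 : K) ≠ 0) (hA : IsSuperSkew A.grading A.bracket) (hB : A.IsMetric B) {k : ℕ}
    (hk : A.lowerSeries k = ⊥) {I₀ : Submodule K V} (hI₀ : A.IsGradedIdeal I₀)
    (hI₀' : I₀ ≤ orth B I₀) :
    ∃ I : Submodule K V, I₀ ≤ I ∧ A.IsGradedIdeal I ∧ I ≤ orth B I ∧
      (orth B I ≤ I ∨ ∃ v ∈ A.grading 0, v ∈ orth B I ∧ B v v = 1 ∧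
        (∀ (x : Fin (m + 1) → V) (i : Fin (m + 1)), x i = v → A.bracket x ∈ I) ∧
        ∀ x ∈ orth B I, x - B x v • v ∈ I) := by
  obtain ⟨I, ⟨hI₀I, hI, hiso⟩, hmax⟩ := WellFounded.has_min
    (wellFounded_gt : WellFounded ((· > ·) : Submodule K V → Submodule K V → Prop))
    {I | I₀ ≤ I ∧ A.IsGradedIdeal I ∧ I ≤ orth B I} ⟨I₀, le_rfl, hI₀, hI₀'⟩
  -- Such a `v` could be adjoined to `I`, giving a larger isotropic graded ideal.
  have hadj : ∀ (b : ZMod 2) (v : V), v ∈ A.grading b → v ∈ orth B I →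
      (∀ (x : Fin (m + 1) → V) (i : Fin (m + 1)), x i = v → A.bracket x ∈ I) →
      B v v = 0 → v ∈ I := by
    intro b v hvb hv hvI hvv
    by_contra hn
    refine hmax (I ⊔ K ∙ v) ⟨hI₀I.trans le_sup_left, hI.sup_span hvb hvI, ?_⟩
      (lt_of_le_of_ne le_sup_left fun h => hn ?_)
    · intro x hx
      refine mem_orth.2 fun y hy => ?_
      obtain ⟨x₁, hx₁, x₂, hx₂, rfl⟩ := Submodule.mem_sup.1 hx
      obtain ⟨y₁, hy₁, y₂, hy₂, rfl⟩ := Submodule.mem_sup.1 hy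
      obtain ⟨s, rfl⟩ := Submodule.mem_span_singleton.1 hx₂
      obtain ⟨t, rfl⟩ := Submodule.mem_span_singleton.1 hy₂
      simp [mem_orth.1 (hiso hx₁) _ hy₁, mem_orth.1 hv _ hy₁, hvv,
        hB.form_flip_eq_zero hI.isGraded hv hx₁]
    · rw [h]
      exact Submodule.mem_sup_right (Submodule.mem_span_singleton_self v)
  -- By maximality `v` is anisotropic, which excludes odd degree; a square root of `(B v v)⁻¹` then
  -- normalizes it.
  have heven : ∀ (a : ZMod 2) (v : V), v ∈ A.grading a → v ∈ orth B I → v ∉ I →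
      (∀ (x : Fin (m + 1) → V) (i : Fin (m + 1)), x i = v → A.bracket x ∈ I) →
      v ∈ A.grading 0 ∧ ∃ c : K, B (c • v) (c • v) = 1 := by
    intro a v hva hv hvI hvc
    have h0 : B v v ≠ 0 := fun h => hvI (hadj a v hva hv hvc h)
    have ha : a = 0 := by
      by_contra ha
      have ha : a = 1 := (by decide : ∀ a : ZMod 2, a ≠ 0 → a = 1) a ha
      exact h0 (hB.form_self_of_odd hchar (ha ▸ hva))
    obtain ⟨c, hc⟩ := IsAlgClosed.exists_eq_mul_self ((B v v)⁻¹)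
    refine ⟨ha ▸ hva, c, ?_⟩
    simp only [map_smul, LinearMap.smul_apply, smul_eq_mul]
    rw [← mul_assoc, ← hc, inv_mul_cancel₀ h0]
  have hscale : ∀ (v : V), (∀ (x : Fin (m + 1) → V) (i : Fin (m + 1)), x i = v →
      A.bracket x ∈ I) → ∀ (c : K) (x : Fin (m + 1) → V) (i : Fin (m + 1)), x i = c • v →
      A.bracket x ∈ I := by
    intro v hv c x i hx
    rw [← Function.update_eq_self i x, hx, MultilinearMap.map_update_smul]
    exact I.smul_mem _ (hv _ i (by simp))
  refine ⟨I, hI₀I, hI, hiso, or_iff_not_imp_left.2 fun hn => ?_⟩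
  have hIo := hB.isGradedIdeal_orth hA hI
  obtain ⟨a, v₀, hva, hv, hvI, hvc⟩ := exists_central_mod hA hk hIo hn
  obtain ⟨hv0, c, hc⟩ := heven a v₀ hva hv hvI hvc
  obtain ⟨v, rfl⟩ : ∃ v, v = c • v₀ := ⟨_, rfl⟩
  have hv0 := (A.grading 0).smul_mem c hv0
  have hv := (orth B I).smul_mem c hv
  have hvc := hscale v₀ hvc c
  generalize c • v₀ = v at *
  refine ⟨v, hv0, hv, hc, hvc, ?_⟩
  have hJ : A.IsGradedIdeal (orth B (I ⊔ K ∙ v)) :=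
    hB.isGradedIdeal_orth hA (hI.sup_span hv0 hvc)
  have hJmem : ∀ x, x ∈ orth B (I ⊔ K ∙ v) ↔ x ∈ orth B I ∧ B x v = 0 := by
    intro x
    constructor
    · intro hx
      exact ⟨mem_orth.2 fun y hy => mem_orth.1 hx y (Submodule.mem_sup_left hy), mem_orth.1 hx v
        (Submodule.mem_sup_right (Submodule.mem_span_singleton_self v))⟩
    · rintro ⟨hx, hxv⟩
      refine mem_orth.2 fun y hy => ?_
      obtain ⟨y₁, hy₁, y₂, hy₂, rfl⟩ := Submodule.mem_sup.1 hy
      obtain ⟨t, rfl⟩ := Submodule.mem_span_singleton.1 hy₂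
      simp [mem_orth.1 hx _ hy₁, hxv]
  -- Otherwise there is a vector `w₀` central modulo `I` and orthogonal to `v`. With `e • w₀` of
  -- norm 1 and `r * r = -1`, the vector `v + (r * e) • w₀` is isotropic, hence in `I`; but its
  -- product with `v`, which is orthogonal to `I`, is 1.
  have hJI : orth B (I ⊔ K ∙ v) ≤ I := by
    by_contra hn
    obtain ⟨a, w₀, hwa, hw, hwI, hwc⟩ := exists_central_mod hA hk hJ hn
    obtain ⟨hwo, hwv⟩ := (hJmem _).1 hw
    obtain ⟨hw0, e, he⟩ := heven a w₀ hwa hwo hwI hwc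
    obtain ⟨r, hr⟩ := IsAlgClosed.exists_eq_mul_self (-1 : K)
    have hvw : B v w₀ = 0 := by
      have := hB.supersymmetric 0 0 v hv0 w₀ hw0
      rwa [hwv, mul_zero] at this
    have hmem : v + (r * e) • w₀ ∈ I := by
      refine hadj 0 _ (add_mem hv0 (Submodule.smul_mem _ _ hw0))
        (add_mem hv (Submodule.smul_mem _ _ hwo)) (fun x i hx => ?_) ?_
      · rw [← Function.update_eq_self i x, hx, MultilinearMap.map_update_add]
        exact add_mem (hvc _ i (by simp)) (hscale w₀ hwc (r * e) _ i (by simp))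
      · simp only [map_smul, LinearMap.smul_apply, smul_eq_mul, map_add, LinearMap.add_apply,
          hc, hvw, hwv] at he ⊢
        linear_combination r * r * he - hr
    have := hB.form_flip_eq_zero hI.isGraded hv hmem
    simp [hc, hwv] at this
  intro x hx
  refine hJI ((hJmem _).2 ⟨sub_mem hx (Submodule.smul_mem _ _ hv), ?_⟩)
  simp [hc]

end Metric

end NSuperalgebra

/-! ### Expanding multilinear maps modulo a subspace -/

theorem comp_snoc {m : ℕ} {α β : Type*} (f : α → β) (x : Fin m → α) (y : α) :
    (fun i => f (Fin.snoc (α := fun _ => α) x y i)) =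
      Fin.snoc (α := fun _ => β) (fun i => f (x i)) (f y) :=
  Fin.comp_snoc f x y

theorem comp_update {ι α β : Type*} [DecidableEq ι] (f : α → β) (x : ι → α) (i : ι) (y : α) :
    (fun j => f (Function.update x i y j)) = Function.update (fun j => f (x j)) i (f y) :=
  Function.comp_update f x i y

theorem map_eq_of_sub_mem {K V M : Type*} [Field K] [AddCommGroup V] [Module K V]
    [AddCommGroup M] [Module K M] {n : ℕ} (f : MultilinearMap K (fun _ : Fin n => V) M)
    {I : Submodule K V} (hf : ∀ x i, x i ∈ I → f x = 0) {x y : Fin n → V}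
    (h : ∀ i, x i - y i ∈ I) : f x = f y := by
  have h1 := f.map_add_univ (x - y) y
  rw [sub_add_cancel, Finset.sum_eq_single ∅ _ (by simp), Finset.piecewise_empty] at h1
  · exact h1
  · intro s _ hs
    obtain ⟨i, hi⟩ := Finset.nonempty_iff_ne_empty.2 hs
    exact hf _ i (by simpa [hi] using h i)

/-- Only the parts of degree at most one in `h` survive. This is the source of the shape of the
`T*`-bracket, with one functional in each coadjoint term. -/
theorem map_add_eq_add_sum_update {K V M : Type*} [Field K] [AddCommGroup V] [Module K V]
    [AddCommGroup M] [Module K M] {n : ℕ} (f : MultilinearMap K (fun _ : Fin n => V) M)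
    {I : Submodule K V} (hf : ∀ x i j, i ≠ j → x i ∈ I → x j ∈ I → f x = 0) {x h : Fin n → V}
    (hh : ∀ i, h i ∈ I) : f (x + h) = f x + ∑ i, f (Function.update x i (h i)) := by
  rw [f.map_add_eq_map_add_linearDeriv_add, f.linearDeriv_apply, add_eq_left]
  refine Finset.sum_eq_zero fun s hs => ?_
  obtain ⟨i, hi, j, hj, hij⟩ := Finset.one_lt_card.1 (Finset.mem_filter.1 hs).2
  exact hf _ i j hij (by simpa [hi] using hh i) (by simpa [hj] using hh j)

/-! ### The quotient by an isotropic ideal, and the cochain defined by a section -/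

namespace NSuperalgebra

variable {K : Type*} [Field K] {m : ℕ} {V : Type*} [AddCommGroup V] [Module K V]

/-- A presentation of a superalgebra with a bilinear form as an extension of a graded space `W` by
an isotropic graded ideal, together with a graded isotropic section. -/
structure LagrangianSplitting (A : NSuperalgebra K m V) (B : LinearMap.BilinForm K V)
    (W : Type*) [AddCommGroup W] [Module K W] where
  /-- the projection -/
  p : V →ₗ[K] W
  /-- the section -/
  s : W →ₗ[K] V
  p_s : ∀ w, p (s w) = w
  ideal : A.IsGradedIdeal (LinearMap.ker p)
  ker_isotropic : ∀ x y, p x = 0 → p y = 0 → B x y = 0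
  section_isotropic : ∀ w w', B (s w) (s w') = 0
  s_p_mem : ∀ a, ∀ x ∈ A.grading a, s (p x) ∈ A.grading a

namespace LagrangianSplitting

variable {A : NSuperalgebra K m V} {B : LinearMap.BilinForm K V} {W : Type*} [AddCommGroup W]
  [Module K W] (S : LagrangianSplitting A B W)

theorem s_mem {a : ZMod 2} {w : W} (hw : w ∈ (A.grading a).map S.p) : S.s w ∈ A.grading a := by
  obtain ⟨x, hx, rfl⟩ := hw
  exact S.s_p_mem a x hx

theorem p_mem {a : ZMod 2} {x : V} (hx : x ∈ A.grading a) : S.p x ∈ (A.grading a).map S.p :=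
  Submodule.mem_map_of_mem hx

/-- The quotient superalgebra. -/
def quotient : NSuperalgebra K m W where
  grading a := (A.grading a).map S.p
  isCompl_zero_one := by
    constructor
    · rw [Submodule.disjoint_def]
      intro w h0 h1
      rw [← S.p_s w, Submodule.disjoint_def.1 A.isCompl_zero_one.disjoint _ (S.s_mem h0)
        (S.s_mem h1), map_zero]
    · rw [codisjoint_iff, ← Submodule.map_sup, codisjoint_iff.1 A.isCompl_zero_one.codisjoint,
        Submodule.map_top, LinearMap.range_eq_top]
      exact fun w => ⟨_, S.p_s w⟩
  bracket := S.p.compMultilinearMap (A.bracket.compLinearMap fun _ => S.s)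
  bracket_mem := fun d x hx => S.p_mem (A.bracket_mem d _ fun i => S.s_mem (hx i))

theorem quotient_bracket_apply (w : Fin (m + 1) → W) :
    S.quotient.bracket w = S.p (A.bracket fun i => S.s (w i)) := rfl

theorem sub_s_p_mem (x : V) : x - S.s (S.p x) ∈ LinearMap.ker S.p := by
  simp [S.p_s]

theorem p_bracket_eq {x y : Fin (m + 1) → V} (h : ∀ i, x i - y i ∈ LinearMap.ker S.p) :
    S.p (A.bracket x) = S.p (A.bracket y) :=
  map_eq_of_sub_mem (S.p.compMultilinearMap A.bracket) (fun x i hx => S.ideal.ideal x i hx) h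

theorem p_bracket (x : Fin (m + 1) → V) :
    S.p (A.bracket x) = S.quotient.bracket fun i => S.p (x i) :=
  S.p_bracket_eq fun i => S.sub_s_p_mem (x i)

/-- An element of the isotropic kernel pairs with `y` only through the class of `y`. -/
theorem form_s_p_right {x : V} (hx : S.p x = 0) (y : V) : B x (S.s (S.p y)) = B x y := by
  have := S.ker_isotropic x _ hx (S.sub_s_p_mem y)
  rw [map_sub, sub_eq_zero] at this
  exact this.symm

theorem quotient_isSuperSkew (hA : IsSuperSkew A.grading A.bracket) :
    IsSuperSkew S.quotient.grading S.quotient.bracket := fun d x hx i => by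
  rw [quotient_bracket_apply, hA d _ (fun j => S.s_mem (hx j)) i, map_neg, map_smul]
  rfl

theorem quotient_isFirstClass (hA : A.IsFirstClass) : S.quotient.IsFirstClass where
  skew := S.quotient_isSuperSkew hA.skew
  filippov := fun a x b y hx hy => by
    have h := congrArg S.p (hA.filippov a (fun i => S.s (x i)) b (fun i => S.s (y i))
      (fun i => S.s_mem (hx i)) (fun i => S.s_mem (hy i)))
    simpa only [p_bracket, map_sum, map_smul, comp_snoc, comp_update, S.p_s] using h

theorem quotient_lowerSeries (j : ℕ) :
    S.quotient.lowerSeries j = (A.lowerSeries j).map S.p := by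
  induction j with
  | zero =>
    symm
    exact (Submodule.map_top _).trans (LinearMap.range_eq_top.2 fun w => ⟨_, S.p_s w⟩)
  | succ j ih =>
    simp only [lowerSeries]
    rw [Submodule.map_span, ih]
    congr 1
    ext w
    constructor
    · rintro ⟨x, ⟨y, hy, hyx⟩, rfl⟩
      refine ⟨_, ⟨Function.update (fun i => S.s (x i)) 0 y, by simpa using hy, rfl⟩, ?_⟩
      rw [p_bracket, comp_update, hyx]
      simp only [S.p_s]
      rw [Function.update_eq_self]
    · rintro ⟨_, ⟨x, hx, rfl⟩, rfl⟩
      exact ⟨_, Submodule.mem_map_of_mem hx, (S.p_bracket x).symm⟩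

theorem exists_isNilpotentOfLength {j : ℕ} (h : A.lowerSeries j ≤ LinearMap.ker S.p) :
    ∃ l, S.quotient.IsNilpotentOfLength l ∧ l ≤ j := by
  classical
  have hj : S.quotient.lowerSeries j = ⊥ := by
    rw [S.quotient_lowerSeries, eq_bot_iff, Submodule.map_le_iff_le_comap]
    exact h
  exact ⟨Nat.find ⟨j, hj⟩, ⟨Nat.find_spec ⟨j, hj⟩, fun i hi => Nat.find_min' _ hi⟩,
    Nat.find_min' _ hj⟩

/-- The functional `w ↦ ⟨x, s w⟩` on `W`. -/
def functional : V →ₗ[K] Dual K W := S.s.dualMap ∘ₗ B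

theorem functional_apply (x : V) (w : W) : S.functional x w = B x (S.s w) := rfl

theorem functional_mem (hB : A.IsMetric B) {a : ZMod 2} {x : V} (hx : x ∈ A.grading a) :
    S.functional x ∈ S.quotient.dualGrading a :=
  (Submodule.mem_dualAnnihilator _).2 fun _ hw =>
    hB.consistent a (a + 1) (by simp) x hx _ (S.s_mem hw)

/-- The cochain `θ(w₁, …)(w) = ⟨[s w₁, …], s w⟩`. -/
def cochain (hA : IsSuperSkew A.grading A.bracket) (hB : A.IsMetric B) :
    S.quotient.OneCochain where
  toFun := S.functional.compMultilinearMap (A.bracket.compLinearMap fun _ => S.s)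
  degree_zero := fun d x hx => S.functional_mem hB (A.bracket_mem d _ fun i => S.s_mem (hx i))
  skew := fun d x hx i => by
    rw [LinearMap.compMultilinearMap_apply, MultilinearMap.compLinearMap_apply,
      hA d _ (fun j => S.s_mem (hx j)) i, map_neg, map_smul]
    rfl

theorem cochain_apply (hA : IsSuperSkew A.grading A.bracket) (hB : A.IsMetric B)
    (x : Fin (m + 1) → W) (w : W) :
    (S.cochain hA hB).toFun x w = B (A.bracket fun i => S.s (x i)) (S.s w) := rfl

/-- This is invariance followed by supersymmetry of the form on the section; the sign
`(-1)^{|x||y|}` occurs twice and cancels. -/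
theorem isSupercyclic_cochain (hA : IsSuperSkew A.grading A.bracket) (hB : A.IsMetric B) :
    S.quotient.IsSupercyclic (S.cochain hA hB) := by
  intro d x b c y z hx hy hz
  have hy := S.s_mem hy
  have hz := S.s_mem hz
  have hx := fun i => S.s_mem (hx i)
  have hbr : A.bracket (Fin.snoc (fun i => S.s (x i)) (S.s z)) ∈ A.grading ((∑ i, d i) + c) := by
    have := A.bracket_mem (Fin.snoc d c) (Fin.snoc (fun i => S.s (x i)) (S.s z)) (fun i => by
      refine Fin.lastCases ?_ (fun j => ?_) i
      · simpa using hz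
      · simpa using hx j)
    rwa [Fin.sum_snoc] at this
  rw [cochain_apply, cochain_apply, comp_snoc, comp_snoc,
    hB.invariant d _ b c _ _ hx hy hz, hB.supersymmetric b _ _ hy _ hbr, mul_add, sgn_add,
    mul_comm b (∑ i, d i)]
  linear_combination (-(sgn K (b * c) * B (A.bracket (Fin.snoc (fun i => S.s (x i)) (S.s z)))
    (S.s y))) * sgn_mul_self (K := K) ((∑ i, d i) * b)

/-- The linear isomorphism `x ↦ p x + ⟨x, s ·⟩` onto `W ⊕ W*`. -/
def equiv [FiniteDimensional K V] (hB : A.IsMetric B) : V ≃ₗ[K] W × Dual K W :=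
  LinearEquiv.ofBijective (S.p.prod S.functional) (by
    have hker : ∀ x, S.p x = 0 → S.functional x = 0 → x = 0 := fun x h1 h2 =>
      hB.nondegenerate x fun y => by
        rw [← S.form_s_p_right h1 y]
        exact LinearMap.congr_fun h2 (S.p y)
    constructor
    · rw [injective_iff_map_eq_zero]
      intro x hx
      exact hker x (congrArg Prod.fst hx) (congrArg Prod.snd hx)
    · rintro ⟨w, f⟩
      -- The vector representing `f ∘ p` lies in the kernel of `p`: its section part `s (p x)` is
      -- orthogonal to the section and, by isotropy of the kernel, to every `y - s (p y)`.
      obtain ⟨x, hx⟩ := hB.bijective.2 (f ∘ₗ S.p)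
      have hx : ∀ y, B x y = f (S.p y) := LinearMap.congr_fun hx
      have hsx : S.s (S.p x) = 0 := by
        refine hB.nondegenerate _ fun y => ?_
        have h1 := hx (y - S.s (S.p y))
        have h2 := S.ker_isotropic _ _ (S.sub_s_p_mem x) (S.sub_s_p_mem y)
        have h3 := S.section_isotropic (S.p x) (S.p y)
        have h4 : S.p (y - S.s (S.p y)) = 0 := S.sub_s_p_mem y
        rw [h4, map_zero] at h1
        rw [map_sub B, LinearMap.sub_apply, h1, zero_sub, neg_eq_zero, map_sub, h3, sub_zero] at h2
        exact h2
      have hpx : S.p x = 0 := by rw [← S.p_s (S.p x), hsx, map_zero]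
      refine ⟨S.s w + x, Prod.ext ?_ ?_⟩
      · simp [S.p_s, hpx]
      · ext w'
        simp [functional_apply, S.section_isotropic, hx, S.p_s])

end LagrangianSplitting

end NSuperalgebra

namespace NSuperalgebra

variable {K : Type*} [Field K] {m : ℕ} {V : Type*} [AddCommGroup V] [Module K V]

/-- The sign is the one in `IsMetric.form_bracket`, so invariance of the form produces exactly the
coadjoint terms. -/
theorem coadAt_apply (A : NSuperalgebra K m V) (d : Fin (m + 1) → ZMod 2) (i : Fin (m + 1))
    (x : Fin (m + 1) → V) (f : Dual K V) (w : V) :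
    A.coadAt d i x f w = -(moveSign K d i * sgn K ((∑ j, i.removeNth d j) * d i) *
      f (A.bracket (Fin.snoc (i.removeNth x) w))) := by
  simp only [coadAt, coad, moveSign, LinearMap.smul_apply, LinearMap.neg_apply,
    LinearMap.comp_apply, ad_apply, smul_eq_mul]
  ring

/-! ### Transport along isometries -/

section Isometric

variable {A : NSuperalgebra K m V} {B : LinearMap.BilinForm K V} {W : Type*} [AddCommGroup W]
  [Module K W] {A' : NSuperalgebra K m W} {B' : LinearMap.BilinForm K W}

theorem Isometric.symm (h : A.Isometric B A' B') : A'.Isometric B' A B := by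
  obtain ⟨φ, hg, hb, hf⟩ := h
  refine ⟨φ.symm, fun a x hx => ?_, fun x => ?_, fun x y => ?_⟩
  · have h1 : φ (A.proj (a + 1) (φ.symm x)) = 0 := by
      refine Submodule.disjoint_def.1 (A'.isCompl a).disjoint _ ?_ (hg _ _ (A.proj_mem _ _))
      have h2 := congrArg φ (A.proj_add_proj a (φ.symm x))
      rw [map_add, φ.apply_symm_apply] at h2
      rw [eq_sub_of_add_eq' h2]
      exact sub_mem hx (hg _ _ (A.proj_mem _ _))
    rw [φ.map_eq_zero_iff] at h1
    rw [← A.proj_add_proj a (φ.symm x), h1, add_zero]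
    exact A.proj_mem _ _
  · rw [φ.symm_apply_eq, hb]
    simp
  · rw [← hf]
    simp

theorem Isometric.isFirstClass (h : A.Isometric B A' B') (hA : A.IsFirstClass) :
    A'.IsFirstClass := by
  obtain ⟨ψ, hg, hb, -⟩ := h.symm
  constructor
  · intro d x hx i
    apply ψ.injective
    rw [map_neg, map_smul, hb, hb, hA.skew d _ (fun j => hg _ _ (hx j)) i]
    rfl
  · intro a x b y hx hy
    apply ψ.injective
    have h := hA.filippov a (fun i => ψ (x i)) b (fun i => ψ (y i)) (fun i => hg _ _ (hx i))
      (fun i => hg _ _ (hy i))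
    simpa only [hb, map_sum, map_smul, comp_snoc,
      comp_update] using h

theorem Isometric.isMetric (h : A.Isometric B A' B') (hB : A.IsMetric B) : A'.IsMetric B' := by
  obtain ⟨ψ, hg, hb, hf⟩ := h.symm
  refine ⟨fun a b hab x hx y hy => ?_, fun a b x hx y hy => ?_, fun d x b c y z hx hy hz => ?_,
    fun x hx => ?_⟩
  · rw [← hf]
    exact hB.consistent a b hab _ (hg _ _ hx) _ (hg _ _ hy)
  · rw [← hf, ← hf]
    exact hB.supersymmetric a b _ (hg _ _ hx) _ (hg _ _ hy)
  · rw [← hf, ← hf, hb, hb, comp_snoc, comp_snoc]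
    exact hB.invariant d _ b c _ _ (fun i => hg _ _ (hx i)) (hg _ _ hy) (hg _ _ hz)
  · refine ψ.map_eq_zero_iff.1 (hB.nondegenerate _ fun y => ?_)
    rw [← ψ.apply_symm_apply y, hf]
    exact hx _

end Isometric

/-! ### The cocycle condition and the Filippov identity of the extension -/

section Cocycle

variable {C : NSuperalgebra K m V} {θ : C.OneCochain}

theorem mem_tGrading_inl {a : ZMod 2} {x : V} (hx : x ∈ C.grading a) :
    ((x, 0) : V × Dual K V) ∈ C.tGrading a := ⟨hx, zero_mem _⟩

theorem coadAt_zero (d : Fin (m + 1) → ZMod 2) (i : Fin (m + 1)) (x : Fin (m + 1) → V) :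
    C.coadAt d i x 0 = 0 := by
  simpa using C.coadAt_smul d i x 0 0

theorem tStar_bracket_inl {d : Fin (m + 1) → ZMod 2} {x : Fin (m + 1) → V}
    (hx : ∀ i, x i ∈ C.grading (d i)) :
    (C.tStar θ).bracket (fun i => (x i, 0)) = (C.bracket x, θ.toFun x) := by
  refine (C.tBracket_apply θ d _ fun i => mem_tGrading_inl (hx i)).trans ?_
  simp [tBracketHom, coadAt_zero]

/-- In the Filippov identity on arguments from the base algebra, only the inner bracket has a dual
component, so each outer bracket has a single coadjoint term. -/
theorem tStar_bracket_update_inl {d : Fin (m + 1) → ZMod 2} {x : Fin (m + 1) → V}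
    (i : Fin (m + 1)) {X : V × Dual K V} (hx : ∀ j, j ≠ i → x j ∈ C.grading (d j))
    (hX : X ∈ C.tGrading (d i)) :
    (C.tStar θ).bracket (Function.update (fun j => (x j, 0)) i X) =
      (C.bracket (Function.update x i X.1),
        θ.toFun (Function.update x i X.1) + C.coadAt d i x X.2) := by
  refine (C.tBracket_apply θ d _ fun j => ?_).trans ?_
  · rcases eq_or_ne j i with rfl | h
    · simpa using hX
    · simpa [h] using mem_tGrading_inl (hx j h)
  · have h1 : (fun j => (Function.update (fun j => ((x j, 0) : V × Dual K V)) i X j).1) =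
        Function.update x i X.1 :=
      comp_update Prod.fst (fun j => ((x j, 0) : V × Dual K V)) i X
    rw [tBracketHom, h1, Finset.sum_eq_single i]
    · rw [Function.update_self, coadAt_update_self]
    · intro j _ hj
      rw [Function.update_of_ne hj, coadAt_zero]
    · simp

theorem coadAt_last (d : Fin m → ZMod 2) (c : ZMod 2) (x : Fin m → V) (z : V) (f : Dual K V) :
    C.coadAt (Fin.snoc d c) (Fin.last m) (Fin.snoc x z) f = C.coad (∑ j, d j) c x f := by
  have h : (Finset.univ.filter fun j => Fin.last m < j) = ∅ := by
    ext j; simp [Fin.le_last]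
  rw [coadAt, h, Fin.removeNth_last, Fin.init_snoc, Fin.removeNth_last, Fin.init_snoc]
  simp [sgn_zero]

theorem sum_lt_castSucc (b : Fin m → ZMod 2) (c : ZMod 2) (i : Fin m) :
    ∑ j with j < i.castSucc, (Fin.snoc b c : Fin (m + 1) → ZMod 2) j = ∑ j with j < i, b j := by
  rw [Finset.sum_filter, Finset.sum_filter, Fin.sum_univ_castSucc]
  simp [Fin.not_lt.2 (Fin.le_last i.castSucc)]

theorem sum_lt_last (b : Fin m → ZMod 2) (c : ZMod 2) :
    ∑ j with j < Fin.last m, (Fin.snoc b c : Fin (m + 1) → ZMod 2) j = ∑ j, b j := by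
  rw [Finset.sum_filter, Fin.sum_univ_castSucc]
  simp [Fin.castSucc_lt_last]

theorem snoc_mem {G : ZMod 2 → Submodule K V} {a : Fin m → ZMod 2} {x : Fin m → V}
    (hx : ∀ i, x i ∈ G (a i)) {c : ZMod 2} {z : V} (hz : z ∈ G c) (i : Fin (m + 1)) :
    (Fin.snoc x z : Fin (m + 1) → V) i ∈ G ((Fin.snoc a c : Fin (m + 1) → ZMod 2) i) := by
  refine Fin.lastCases ?_ (fun j => ?_) i
  · simpa using hz
  · simpa using hx j

/-- The component in the dual space of the Filippov identity of the `T*`-extension. -/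
theorem filippov_dual (h : (C.tStar θ).IsFirstClass) {a : Fin m → ZMod 2} {x : Fin m → V}
    {b : Fin (m + 1) → ZMod 2} {y : Fin (m + 1) → V} (hx : ∀ i, x i ∈ C.grading (a i))
    (hy : ∀ i, y i ∈ C.grading (b i)) :
    θ.toFun (Fin.snoc x (C.bracket y)) + C.coad (∑ j, a j) (∑ j, b j) x (θ.toFun y) =
      ∑ i, sgn K ((∑ j, a j) * ∑ j with j < i, b j) •
        (θ.toFun (Function.update y i (C.ad x (y i))) +
          C.coadAt (Function.update b i ((∑ j, a j) + b i)) i y (θ.toFun (Fin.snoc x (y i)))) := by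
  have h1 := h.filippov a (fun i => (x i, 0)) b (fun i => (y i, 0))
    (fun i => mem_tGrading_inl (hx i)) (fun i => mem_tGrading_inl (hy i))
  have hb : ∀ i, (C.tStar θ).bracket (Fin.snoc (fun i => (x i, 0)) (y i, 0)) =
      (C.ad x (y i), θ.toFun (Fin.snoc x (y i))) := fun i => by
    have h2 := tStar_bracket_inl (θ := θ) (snoc_mem hx (hy i))
    rwa [comp_snoc (fun v : V => ((v, 0) : V × Dual K V))] at h2
  have hl : (C.tStar θ).bracket (Fin.snoc (fun i => (x i, 0)) (C.bracket y, θ.toFun y)) =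
      (C.bracket (Fin.snoc x (C.bracket y)), θ.toFun (Fin.snoc x (C.bracket y)) +
        C.coad (∑ j, a j) (∑ j, b j) x (θ.toFun y)) := by
    have h2 := tStar_bracket_update_inl (C := C) (θ := θ) (d := Fin.snoc a (∑ j, b j))
      (x := Fin.snoc x 0) (Fin.last m) (X := (C.bracket y, θ.toFun y))
      (fun j _ => snoc_mem hx (zero_mem _) j)
      (by simpa using ⟨C.bracket_mem b y hy, θ.degree_zero b y hy⟩)
    rwa [comp_snoc (fun v : V => ((v, 0) : V × Dual K V)),
      Fin.update_snoc_last, Fin.update_snoc_last, coadAt_last] at h2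
  have hr : ∀ i, (C.tStar θ).bracket (Function.update (fun i => (y i, 0)) i
      (C.ad x (y i), θ.toFun (Fin.snoc x (y i)))) =
      (C.bracket (Function.update y i (C.ad x (y i))),
        θ.toFun (Function.update y i (C.ad x (y i))) +
        C.coadAt (Function.update b i ((∑ j, a j) + b i)) i y (θ.toFun (Fin.snoc x (y i)))) := by
    intro i
    refine tStar_bracket_update_inl i (fun j hj => by simpa [hj] using hy j) ?_
    have h3 := C.bracket_mem _ _ (snoc_mem hx (hy i))
    have h4 := θ.degree_zero _ _ (snoc_mem hx (hy i))
    rw [Fin.sum_snoc] at h3 h4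
    rw [Function.update_self]
    exact ⟨h3, h4⟩
  rw [tStar_bracket_inl hy, hl] at h1
  have h2 := congrArg Prod.snd h1
  simpa only [hb, hr, Prod.snd_sum, Prod.smul_snd] using h2

/-- The coboundary is the difference of the two sides of `filippov_dual` for the tuple `(y, z)`,
with the summand of the last place split off. -/
theorem isCocycle_of_isFirstClass (h : (C.tStar θ).IsFirstClass) : C.IsCocycle θ := by
  intro a x b y c z hx hy hz
  have h1 := filippov_dual h hx (snoc_mem hy hz)
  rw [Fin.sum_snoc, Fin.sum_univ_castSucc, sum_lt_last] at h1
  simp only [sum_lt_castSucc, Fin.snoc_castSucc, Fin.snoc_last, ← Fin.snoc_update,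
    Fin.update_snoc_last, coadAt_last, smul_add, Finset.sum_add_distrib] at h1
  rw [coboundary]
  rw [← ad_apply, ← sub_eq_zero] at h1
  rw [← h1]
  abel

end Cocycle

/-! ### The isometry with the `T*`-extension -/

namespace LagrangianSplitting

variable {A : NSuperalgebra K m V} {B : LinearMap.BilinForm K V} {W : Type*} [AddCommGroup W]
  [Module K W] (S : LagrangianSplitting A B W)

/-- Invariance isolates one kernel entry; the other stays inside the bracket, which therefore lies
in the kernel, and the kernel is isotropic. -/
theorem form_bracket_eq_zero_of_two (hA : IsSuperSkew A.grading A.bracket) (hB : A.IsMetric B)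
    {c : ZMod 2} {z : V} (hz : z ∈ A.grading c) (x : Fin (m + 1) → V) (i j : Fin (m + 1))
    (hij : i ≠ j) (hi : x i ∈ LinearMap.ker S.p) (hj : x j ∈ LinearMap.ker S.p) :
    (LinearMap.flip B z).compMultilinearMap A.bracket x = 0 := by
  rw [A.map_eq_sum_proj]
  refine Finset.sum_eq_zero fun d _ => ?_
  rw [LinearMap.compMultilinearMap_apply, LinearMap.flip_apply,
    hB.form_bracket hA (fun k => A.proj_mem (d k) (x k)) i hz]
  obtain ⟨k, rfl⟩ := Fin.exists_succAbove_eq hij.symm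
  rw [S.ker_isotropic _ _ (S.ideal.graded _ hi _) (S.ideal.ideal _ k.castSucc (by
    rw [Fin.snoc_castSucc]; exact S.ideal.graded _ hj _)), mul_zero, neg_zero]

theorem form_bracket_section (hA : IsSuperSkew A.grading A.bracket) (hB : A.IsMetric B)
    {d : Fin (m + 1) → ZMod 2} {x : Fin (m + 1) → V} (hx : ∀ i, x i ∈ A.grading (d i))
    {c : ZMod 2} {w : W} (hw : w ∈ S.quotient.grading c) :
    B (A.bracket x) (S.s w) = B (A.bracket fun i => S.s (S.p (x i))) (S.s w) +
      ∑ i, S.quotient.coadAt d i (fun j => S.p (x j)) (S.functional (x i)) w := by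
  have hz := S.s_mem hw
  have h := map_add_eq_add_sum_update ((LinearMap.flip B (S.s w)).compMultilinearMap A.bracket)
    (S.form_bracket_eq_zero_of_two hA hB hz) (x := fun i => S.s (S.p (x i)))
    (h := fun i => x i - S.s (S.p (x i))) (fun i => S.sub_s_p_mem (x i))
  have hadd : (fun i => S.s (S.p (x i))) + (fun i => x i - S.s (S.p (x i))) = x := by
    ext i; simp
  rw [hadd] at h
  refine h.trans (congrArg _ (Finset.sum_congr rfl fun i _ => ?_))
  -- After invariance, `x i - s (p (x i))` is paired with an element that may be replaced by one of
  -- the section; there `s (p (x i))` contributes nothing, and the functional of `x i` remains.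
  rw [LinearMap.compMultilinearMap_apply, LinearMap.flip_apply,
    hB.form_bracket hA (d := d) (fun j => ?_) i hz, coadAt_apply, Fin.removeNth_update,
    Function.update_self, functional_apply, quotient_bracket_apply,
    ← S.form_s_p_right (S.sub_s_p_mem (x i)), comp_snoc, map_sub B, LinearMap.sub_apply,
    S.section_isotropic, sub_zero]
  · rfl
  · rcases eq_or_ne j i with rfl | hj
    · simpa using sub_mem (hx j) (S.s_p_mem _ _ (hx j))
    · simpa [hj] using S.s_p_mem _ _ (hx j)

variable [FiniteDimensional K V]

theorem equiv_mem (hB : A.IsMetric B) {a : ZMod 2} {x : V} (hx : x ∈ A.grading a) :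
    S.equiv hB x ∈ S.quotient.tGrading a :=
  ⟨S.p_mem hx, S.functional_mem hB hx⟩

theorem equiv_bracket (hA : IsSuperSkew A.grading A.bracket) (hB : A.IsMetric B)
    (x : Fin (m + 1) → V) :
    S.equiv hB (A.bracket x) =
      (S.quotient.tStar (S.cochain hA hB)).bracket fun i => S.equiv hB (x i) := by
  refine A.map_eq_of_homogeneous ((S.equiv hB).toLinearMap.compMultilinearMap A.bracket)
    ((S.quotient.tStar (S.cochain hA hB)).bracket.compLinearMap fun _ => (S.equiv hB).toLinearMap)
    (fun d y hy => ?_) x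
  refine Eq.trans ?_ (S.quotient.tBracket_apply _ d _ fun i => S.equiv_mem hB (hy i)).symm
  refine Prod.ext (S.p_bracket y) (LinearMap.ext fun w => ?_)
  rw [← S.quotient.sum_proj w, map_sum, map_sum]
  refine Finset.sum_congr rfl fun c _ => ?_
  refine (S.form_bracket_section hA hB hy (S.quotient.proj_mem c w)).trans ?_
  simp only [tBracketHom, LinearMap.add_apply, LinearMap.sum_apply]
  rfl

theorem tForm_equiv (hB : A.IsMetric B) (x y : V) :
    S.quotient.tForm (S.equiv hB x) (S.equiv hB y) = B x y := by
  have key : ∀ (a b : ZMod 2) (x y : V), x ∈ A.grading a → y ∈ A.grading b →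
      S.quotient.tForm (S.equiv hB x) (S.equiv hB y) = B x y := by
    intro a b x y hx hy
    rw [S.quotient.tForm_apply a b _ _ (S.equiv_mem hB hx) (S.equiv_mem hB hy)]
    -- Expanded, this says `⟨x, y⟩ = ⟨x, s p y⟩ + ⟨s p x, y⟩`, since the section is isotropic.
    have h := S.ker_isotropic _ _ (S.sub_s_p_mem x) (S.sub_s_p_mem y)
    simp only [map_sub, LinearMap.sub_apply, S.section_isotropic] at h
    rw [hB.supersymmetric a b _ (S.s_p_mem _ _ hx) _ hy] at h
    change B x (S.s (S.p y)) + sgn K (a * b) * B y (S.s (S.p x)) = _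
    linear_combination -h
  rw [← A.sum_proj x, ← A.sum_proj y]
  simp only [map_sum, LinearMap.sum_apply]
  exact Finset.sum_congr rfl fun b _ => Finset.sum_congr rfl fun a _ =>
    key _ _ _ _ (A.proj_mem _ _) (A.proj_mem _ _)

theorem isometric (hA : IsSuperSkew A.grading A.bracket) (hB : A.IsMetric B) :
    A.Isometric B (S.quotient.tStar (S.cochain hA hB)) S.quotient.tForm :=
  ⟨S.equiv hB, fun _ _ hx => S.equiv_mem hB hx, S.equiv_bracket hA hB, S.tForm_equiv hB⟩

theorem definesTStarExtension (hA : A.IsFirstClass) (hB : A.IsMetric B) :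
    S.quotient.DefinesTStarExtension (S.cochain hA.skew hB) :=
  ⟨isCocycle_of_isFirstClass ((S.isometric hA.skew hB).isFirstClass hA),
    S.isSupercyclic_cochain hA.skew hB⟩

end LagrangianSplitting

end NSuperalgebra

/-! ### Graded isotropic sections -/

namespace NSuperalgebra

variable {K : Type*} [Field K] {m : ℕ} {V : Type*} [AddCommGroup V] [Module K V]
  {A : NSuperalgebra K m V} {B : LinearMap.BilinForm K V}

theorem mem_grading_of_proj_eq_zero {a : ZMod 2} {x : V} (h : A.proj (a + 1) x = 0) :
    x ∈ A.grading a := by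
  rw [← A.proj_add_proj a x, h, add_zero]
  exact A.proj_mem a x

theorem exists_graded_section {W : Type*} [AddCommGroup W] [Module K W] {p : V →ₗ[K] W}
    (hp : Function.Surjective p) (hI : A.IsGraded (LinearMap.ker p)) :
    ∃ s : W →ₗ[K] V, (∀ w, p (s w) = w) ∧ ∀ a, ∀ x ∈ A.grading a, s (p x) ∈ A.grading a := by
  obtain ⟨r, hr⟩ := p.exists_rightInverse_of_surjective (LinearMap.range_eq_top.2 hp)
  have hr : ∀ w, p (r w) = w := LinearMap.congr_fun hr
  have hpr : ∀ a x, p (A.proj a (r (p x))) = p (A.proj a x) := fun a x => by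
    have h := hI (r (p x) - x) (by simp [hr]) a
    rwa [LinearMap.mem_ker, map_sub, map_sub, sub_eq_zero] at h
  -- The map `p ∘ A.proj a ∘ r` is the degree `a` projection induced on `W`; the sum is the
  -- degree-preserving part of `r`.
  refine ⟨∑ a : ZMod 2, A.proj a ∘ₗ r ∘ₗ p ∘ₗ A.proj a ∘ₗ r, fun w => ?_, fun b x hx => ?_⟩
  · simp only [LinearMap.sum_apply, LinearMap.comp_apply, map_sum, hpr]
    simp only [A.proj_of_mem (A.proj_mem _ _)]
    rw [← map_sum, A.sum_proj, hr]
  · simp only [LinearMap.sum_apply, LinearMap.comp_apply, hpr]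
    refine Submodule.sum_mem _ fun a _ => ?_
    rw [A.proj_of_homogeneous hx]
    split_ifs with h
    · exact h ▸ A.proj_mem _ _
    · simp

/-- A Lagrangian graded ideal has a graded isotropic complement. -/
theorem IsMetric.exists_lagrangianSplitting [FiniteDimensional K V] (hchar : (2 : K) ≠ 0)
    (hB : A.IsMetric B) {W : Type*} [AddCommGroup W] [Module K W] {p : V →ₗ[K] W}
    (hp : Function.Surjective p) (hI : A.IsGradedIdeal (LinearMap.ker p))
    (hlag : orth B (LinearMap.ker p) = LinearMap.ker p) :
    ∃ S : LagrangianSplitting A B W, S.p = p := by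
  obtain ⟨s, hs, hsg⟩ := exists_graded_section hp hI.isGraded
  -- In the form on `s + t`, each mixed term contributes minus one half of the form on `s`, and the
  -- `t`-`t` term vanishes. The functional of `t w` kills the kernel of `p`, so `t w` lies in that
  -- kernel and `s + t` is still a section.
  obtain ⟨t, ht⟩ : ∃ t : W →ₗ[K] V, ∀ w y, B (t w) y = -(1 / 2) * B (s w) (s (p y)) := by
    refine ⟨(LinearEquiv.ofBijective B hB.bijective).symm.toLinearMap ∘ₗ
      ((-(1 / 2 : K)) • (p.dualMap ∘ₗ s.dualMap ∘ₗ B ∘ₗ s)), fun w y => ?_⟩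
    have h := LinearEquiv.apply_symm_apply (LinearEquiv.ofBijective B hB.bijective)
      (((-(1 / 2 : K)) • (p.dualMap ∘ₗ s.dualMap ∘ₗ B ∘ₗ s)) w)
    exact LinearMap.congr_fun h y
  have htk : ∀ w, p (t w) = 0 := fun w => by
    rw [← LinearMap.mem_ker, ← hlag]
    exact mem_orth.2 fun y hy => by rw [ht, LinearMap.mem_ker.1 hy, map_zero, map_zero, mul_zero]
  have htg : ∀ a, ∀ x ∈ A.grading a, t (p x) ∈ A.grading a := fun a x hx => by
    refine mem_grading_of_proj_eq_zero (hB.nondegenerate _ fun y => ?_)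
    rw [hB.form_proj, ht, hB.consistent a (a + 1) (by simp) _ (hsg a x hx) _
      (hsg _ _ (A.proj_mem _ _)), mul_zero]
  have hiso : ∀ x y, B (s (p x) + t (p x)) (s (p y) + t (p y)) = 0 := by
    intro x y
    rw [← A.sum_proj x, ← A.sum_proj y]
    simp only [map_sum, ← Finset.sum_add_distrib, LinearMap.sum_apply]
    refine Finset.sum_eq_zero fun b _ => Finset.sum_eq_zero fun a _ => ?_
    have hx := A.proj_mem a x
    have hy := A.proj_mem b y
    have h1 := hB.supersymmetric a b _ (hsg a _ hx) _ (htg b _ hy)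
    have h2 := hB.supersymmetric a b _ (hsg a _ hx) _ (hsg b _ hy)
    have h3 := ht (p (A.proj a x)) (s (p (A.proj b y)))
    have h4 := ht (p (A.proj b y)) (s (p (A.proj a x)))
    have h5 := ht (p (A.proj a x)) (t (p (A.proj b y)))
    rw [hs] at h3 h4
    rw [htk, map_zero, map_zero, mul_zero] at h5
    simp only [map_add, LinearMap.add_apply]
    rw [h3, h5, h1, h4]
    field_simp
    linear_combination h2
  refine ⟨⟨p, s + t, fun w => by simp [hs, htk], hI, fun x y hx hy => ?_, fun w w' => ?_,
    fun a x hx => add_mem (hsg a x hx) (htg a x hx)⟩, rfl⟩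
  · exact mem_orth.1 (hlag.ge (LinearMap.mem_ker.2 hx)) y hy
  · obtain ⟨x, rfl⟩ := hp w
    obtain ⟨y, rfl⟩ := hp w'
    exact hiso x y

/-! ### One-dimensional even central extension -/

/-- The direct sum of a superalgebra with an even central line. -/
def addCentral (A : NSuperalgebra K m V) : NSuperalgebra K m (V × K) where
  grading a := (A.grading a).prod (if a = 0 then ⊤ else ⊥)
  isCompl_zero_one := by
    constructor
    · rw [Submodule.disjoint_def]
      rintro ⟨x, t⟩ hx hy
      exact Prod.ext (Submodule.disjoint_def.1 A.isCompl_zero_one.disjoint x hx.1 hy.1)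
        (by simpa using hy.2)
    · rw [codisjoint_iff, Submodule.prod_sup_prod, codisjoint_iff.1 A.isCompl_zero_one.codisjoint]
      simp
  bracket := (LinearMap.inl K V K).compMultilinearMap
    (A.bracket.compLinearMap fun _ => LinearMap.fst K V K)
  bracket_mem := fun d x hx => ⟨A.bracket_mem d _ fun i => (hx i).1, zero_mem _⟩

theorem addCentral_bracket (X : Fin (m + 1) → V × K) :
    A.addCentral.bracket X = (A.bracket fun i => (X i).1, 0) := rfl

theorem snd_eq_zero_of_mem {a : ZMod 2} (ha : a ≠ 0) {X : V × K}
    (hX : X ∈ A.addCentral.grading a) : X.2 = 0 := by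
  have := hX.2
  rwa [if_neg ha] at this

/-- The form on the direct sum with a line that is negative on the line. -/
def centralForm (B : LinearMap.BilinForm K V) : LinearMap.BilinForm K (V × K) :=
  B.compl₁₂ (LinearMap.fst K V K) (LinearMap.fst K V K) -
    (LinearMap.mul K K).compl₁₂ (LinearMap.snd K V K) (LinearMap.snd K V K)

theorem centralForm_apply (X Y : V × K) : centralForm B X Y = B X.1 Y.1 - X.2 * Y.2 := rfl

theorem isFirstClass_addCentral (hA : A.IsFirstClass) : A.addCentral.IsFirstClass where
  skew := fun d x hx i => by
    rw [addCentral_bracket, hA.skew d _ (fun j => (hx j).1) i]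
    ext
    · rfl
    · simp [addCentral_bracket]
  filippov := fun a x b y hx hy => by
    have h := hA.filippov a (fun i => (x i).1) b (fun i => (y i).1) (fun i => (hx i).1)
      (fun i => (hy i).1)
    simp only [addCentral_bracket, comp_snoc Prod.fst,
      comp_update Prod.fst]
    rw [h]
    ext <;> simp [Prod.fst_sum, Prod.snd_sum]

theorem isMetric_centralForm (hB : A.IsMetric B) : A.addCentral.IsMetric (centralForm B) where
  consistent := fun a b hab x hx y hy => by
    have h : x.2 * y.2 = 0 := by
      rcases eq_or_ne a 0 with ha | ha
      · rw [snd_eq_zero_of_mem (fun hb => hab (ha.trans hb.symm)) hy, mul_zero]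
      · rw [snd_eq_zero_of_mem ha hx, zero_mul]
    rw [centralForm_apply, h, hB.consistent a b hab _ hx.1 _ hy.1, sub_zero]
  supersymmetric := fun a b x hx y hy => by
    have h : x.2 * y.2 = sgn K (a * b) * (y.2 * x.2) := by
      rcases eq_or_ne a 0 with rfl | ha
      · rw [zero_mul, sgn_zero, one_mul, mul_comm]
      · rw [snd_eq_zero_of_mem ha hx, zero_mul, mul_zero, mul_zero]
    rw [centralForm_apply, centralForm_apply, hB.supersymmetric a b _ hx.1 _ hy.1, h, mul_sub]
  invariant := fun d x b c y z hx hy hz => by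
    simp only [centralForm_apply, addCentral_bracket, zero_mul, mul_zero, sub_zero,
      comp_snoc Prod.fst]
    exact hB.invariant d _ b c _ _ (fun i => (hx i).1) hy.1 hz.1
  nondegenerate := fun x hx => by
    refine Prod.ext (hB.nondegenerate _ fun y => ?_) ?_
    · simpa [centralForm_apply] using hx (y, 0)
    · simpa [centralForm_apply] using hx (0, 1)

theorem addCentral_proj (a : ZMod 2) (X : V × K) :
    A.addCentral.proj a X = (A.proj a X.1, if a = 0 then X.2 else 0) := by
  have h : ∀ b, ((A.proj b X.1, if b = 0 then X.2 else 0) : V × K) ∈ A.addCentral.grading b :=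
    fun b => ⟨A.proj_mem b _, by dsimp only; split_ifs <;> simp⟩
  have hX : X = (A.proj a X.1, if a = 0 then X.2 else 0) +
      (A.proj (a + 1) X.1, if a + 1 = 0 then X.2 else 0) := by
    refine Prod.ext (A.proj_add_proj a X.1).symm ?_
    rcases (by decide : ∀ a : ZMod 2, (a = 0 ∧ a + 1 ≠ 0) ∨ (a ≠ 0 ∧ a + 1 = 0)) a with h | h <;>
      simp [h]
  conv_lhs => rw [hX, map_add, A.addCentral.proj_of_mem (h a),
    A.addCentral.proj_of_mem_ne (h (a + 1)) (by simp), add_zero]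

/-- Brackets have no component on the central line, which therefore appears only in the term of
index `0`; hence the shift to `j + 1`. -/
theorem lowerSeries_addCentral (j : ℕ) :
    A.addCentral.lowerSeries (j + 1) ≤ (A.lowerSeries (j + 1)).prod ⊥ := by
  induction j with
  | zero =>
    refine Submodule.span_le.2 ?_
    rintro _ ⟨x, -, rfl⟩
    exact ⟨Submodule.subset_span ⟨_, trivial, rfl⟩, zero_mem _⟩
  | succ j ih =>
    refine Submodule.span_le.2 ?_
    rintro _ ⟨x, hx, rfl⟩
    exact ⟨Submodule.subset_span ⟨_, (ih hx).1, rfl⟩, zero_mem _⟩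

/-- The projection of the direct sum with a line onto the quotient by the span of `I` and
`(v, 1)`. -/
def centralProj (I : Submodule K V) (v : V) : V × K →ₗ[K] V ⧸ I :=
  I.mkQ ∘ₗ (LinearMap.fst K V K - (LinearMap.snd K V K).smulRight v)

theorem mem_ker_centralProj {I : Submodule K V} {v : V} {X : V × K} :
    X ∈ LinearMap.ker (centralProj I v) ↔ X.1 - X.2 • v ∈ I := by
  exact Submodule.Quotient.mk_eq_zero I

theorem isGradedIdeal_ker_centralProj {I : Submodule K V} (hI : A.IsGradedIdeal I) {v : V}
    (hv : v ∈ A.grading 0)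
    (hvI : ∀ (x : Fin (m + 1) → V) (i : Fin (m + 1)), x i = v → A.bracket x ∈ I) :
    A.addCentral.IsGradedIdeal (LinearMap.ker (centralProj I v)) := by
  refine ⟨fun X hX a => ?_, fun X i hX => ?_⟩
  · rw [mem_ker_centralProj] at hX ⊢
    have h := hI.graded _ hX a
    rw [map_sub, map_smul, A.proj_of_homogeneous hv] at h
    rw [addCentral_proj]
    simpa [eq_comm, ite_smul] using h
  · rw [mem_ker_centralProj] at hX ⊢
    rw [addCentral_bracket, zero_smul, sub_zero, ← Function.update_eq_self i (fun i => (X i).1),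
      ← sub_add_cancel (X i).1 ((X i).2 • v), MultilinearMap.map_update_add,
      MultilinearMap.map_update_smul]
    exact add_mem (hI.ideal _ i (by simpa using hX)) (I.smul_mem _ (hvI _ i (by simp)))

/-- The kernel is `I + K(v, 1)`, and `(v, 1)` has norm `1 - 1 = 0`. Conversely, orthogonality of
`(x, t)` to `I` and to `(v, 1)` gives `x ∈ orth B I` and `t = B x v`, so `x - t • v ∈ I`. -/
theorem IsMetric.orth_ker_centralProj (hB : A.IsMetric B) {I : Submodule K V}
    (hI : A.IsGraded I) (hiso : I ≤ orth B I) {v : V} (hv : v ∈ orth B I) (hvv : B v v = 1)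
    (h : ∀ x ∈ orth B I, x - B x v • v ∈ I) :
    orth (centralForm B) (LinearMap.ker (centralProj I v)) = LinearMap.ker (centralProj I v) := by
  ext ⟨x, t⟩
  rw [mem_orth, mem_ker_centralProj]
  constructor
  · intro hx
    have h1 : x ∈ orth B I := mem_orth.2 fun y hy => by
      simpa [centralForm_apply] using hx (y, 0) (mem_ker_centralProj.2 (by simpa using hy))
    have h2 := hx (v, 1) (mem_ker_centralProj.2 (by simp))
    simp only [centralForm_apply, mul_one, sub_eq_zero] at h2
    exact h2 ▸ h x h1
  · rintro hx ⟨y, r⟩ hy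
    rw [mem_ker_centralProj] at hy
    have h1 := mem_orth.1 (hiso hx) _ hy
    have h2 := mem_orth.1 hv _ hy
    have h3 := hB.form_flip_eq_zero hI hv hx
    simp only [map_sub, map_smul, LinearMap.sub_apply, LinearMap.smul_apply, smul_eq_mul, hvv]
      at h1 h2 h3
    rw [centralForm_apply]
    linear_combination h1 + t * h2 + r * h3

/-- The original superalgebra is a nondegenerate graded ideal of codimension one in its central
extension. -/
theorem Isometric.exists_isGradedIdeal [FiniteDimensional K V] (hB : A.IsMetric B)
    {U : Type*} [AddCommGroup U] [Module K U] {A' : NSuperalgebra K m U}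
    {B' : LinearMap.BilinForm K U} (h : A.addCentral.Isometric (centralForm B) A' B') :
    ∃ (I : Submodule K U) (hI : A'.IsGradedIdeal I), finrank K (U ⧸ I) = 1 ∧
      (∀ x ∈ I, (∀ y ∈ I, B' x y = 0) → x = 0) ∧
      A.Isometric B (A'.restrict I hI) (B'.restrict I) := by
  obtain ⟨φ, hg, hb, hf⟩ := h
  have hinj : Function.Injective (φ.toLinearMap ∘ₗ LinearMap.inl K V K) :=
    φ.injective.comp LinearMap.inl_injective
  have hgr : ∀ a, ∀ x ∈ A.grading a, φ (x, 0) ∈ A'.grading a :=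
    fun a x hx => hg a _ ⟨hx, zero_mem _⟩
  have hform : ∀ x y : V, B' (φ (x, 0)) (φ (y, 0)) = B x y := fun x y => by
    rw [hf, centralForm_apply, mul_zero, sub_zero]
  have hI : A'.IsGradedIdeal (LinearMap.range (φ.toLinearMap ∘ₗ LinearMap.inl K V K)) := by
    constructor
    · rintro _ ⟨x, rfl⟩ a
      refine ⟨A.proj a x, ?_⟩
      change φ (A.proj a x, 0) = A'.proj a (φ (x, 0))
      have h1 : ((x, 0) : V × K) = (A.proj a x, 0) + (A.proj (a + 1) x, 0) :=
        Prod.ext (A.proj_add_proj a x).symm (add_zero 0).symm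
      rw [h1, map_add, map_add, A'.proj_of_mem (hgr _ _ (A.proj_mem a x)),
        A'.proj_of_mem_ne (hgr _ _ (A.proj_mem (a + 1) x)) (by simp), add_zero]
    · intro x i _
      -- Every bracket of the central extension has zero component on the line, so it lies in the
      -- image of `V`.
      refine ⟨A.bracket fun i => (φ.symm (x i)).1, ?_⟩
      have h1 := hb fun i => φ.symm (x i)
      simp only [φ.apply_symm_apply] at h1
      exact h1
  refine ⟨_, hI, ?_, ?_, LinearEquiv.ofInjective _ hinj, ?_, ?_, ?_⟩
  · have := Module.Finite.equiv φ
    have h1 := Submodule.finrank_quotient_add_finrank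
      (LinearMap.range (φ.toLinearMap ∘ₗ LinearMap.inl K V K))
    rw [LinearMap.finrank_range_of_inj hinj, ← φ.finrank_eq, finrank_prod, finrank_self] at h1
    omega
  · rintro _ ⟨x, rfl⟩ hx
    have : x = 0 := hB.nondegenerate x fun y => by
      rw [← hform]
      exact hx _ ⟨y, rfl⟩
    rw [this, map_zero]
  · exact hgr
  · intro x
    exact Subtype.ext (hb fun i => (x i, 0))
  · exact hform

end NSuperalgebra

end NLieSuper

end

/-! ### The main theorem -/

theorem mainTheorem1 {K : Type u} [Field K] [IsAlgClosed K] (hchar : ringChar K ≠ 2)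
    (m : ℕ) (hm : 1 ≤ m)
    {V : Type v} [AddCommGroup V] [Module K V] [FiniteDimensional K V]
    (A : NLieSuper.NSuperalgebra K m V) (hA : A.IsFirstClass)
    (B : LinearMap.BilinForm K V) (hB : A.IsMetric B)
    (k : ℕ) (hk : A.IsNilpotentOfLength k) :
    ∃ (W : Type v) (_ : AddCommGroup W) (_ : Module K W)
      (C : NLieSuper.NSuperalgebra K m W) (l : ℕ) (θ : C.OneCochain),
      C.IsFirstClass ∧ C.IsNilpotentOfLength l ∧ l ≤ (k + 1) / 2 ∧
      C.DefinesTStarExtension θ ∧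
      (C.tStar θ).IsFirstClass ∧ (C.tStar θ).IsMetric C.tForm ∧
      (A.Isometric B (C.tStar θ) C.tForm ∨
        ∃ (I : Submodule K (W × Module.Dual K W)) (hI : (C.tStar θ).IsGradedIdeal I),
          Module.finrank K ((W × Module.Dual K W) ⧸ I) = 1 ∧
          (∀ x ∈ I, (∀ y ∈ I, C.tForm x y = 0) → x = 0) ∧
          A.Isometric B ((C.tStar θ).restrict I hI) (C.tForm.restrict I)) := by
  have h2 : (2 : K) ≠ 0 := Ring.two_ne_zero hchar
  have hk0 : A.lowerSeries k = ⊥ := hk.1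
  -- The term of index `(k + 1) / 2` is isotropic because twice this index is at least `k`.
  obtain ⟨I, hI₀, hI, hiso, hcase⟩ := hB.exists_maximal_isotropic h2 hA.skew hk0
    (NLieSuper.NSuperalgebra.isGradedIdeal_lowerSeries hA.skew ((k + 1) / 2))
    (hB.form_lowerSeries hA.skew hk0 _ _ (by omega))
  rcases hcase with hlag | ⟨v, hv0, hv, hvv, hvI, hcomp⟩
  · obtain ⟨S, hS⟩ := hB.exists_lagrangianSplitting h2 (p := I.mkQ) I.mkQ_surjective
      (by rwa [I.ker_mkQ]) (by rw [I.ker_mkQ]; exact le_antisymm hlag hiso)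
    obtain ⟨l, hl, hlk⟩ := S.exists_isNilpotentOfLength (j := (k + 1) / 2)
      (by rwa [hS, I.ker_mkQ])
    have hiso := S.isometric hA.skew hB
    exact ⟨V ⧸ I, inferInstance, inferInstance, S.quotient, l, S.cochain hA.skew hB,
      S.quotient_isFirstClass hA, hl, hlk, S.definesTStarExtension hA hB, hiso.isFirstClass hA,
      hiso.isMetric hB, Or.inl hiso⟩
  · have hA' := NLieSuper.NSuperalgebra.isFirstClass_addCentral hA
    have hB' := NLieSuper.NSuperalgebra.isMetric_centralForm hB
    obtain ⟨S, hS⟩ := hB'.exists_lagrangianSplitting h2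
      (p := NLieSuper.NSuperalgebra.centralProj I v)
      (fun w => by
        obtain ⟨x, rfl⟩ := I.mkQ_surjective w
        exact ⟨(x, 0), by simp [NLieSuper.NSuperalgebra.centralProj]⟩)
      (NLieSuper.NSuperalgebra.isGradedIdeal_ker_centralProj hI hv0 hvI)
      (hB.orth_ker_centralProj hI.isGraded hiso hv hvv hcomp)
    -- The index must be positive for `lowerSeries_addCentral` to apply. If it were zero, then `k =
    -- 0` and `V = 0`, against `B v v = 1`.
    obtain ⟨j, hj⟩ : ∃ j, (k + 1) / 2 = j + 1 := Nat.exists_eq_succ_of_ne_zero fun h => by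
      have hk1 : k = 0 := by omega
      subst hk1
      have hv1 : v = 0 := (Submodule.mem_bot K).1 (hk0 ▸ (trivial : v ∈ (⊤ : Submodule K V)))
      simp [hv1] at hvv
    obtain ⟨l, hl, hlk⟩ := S.exists_isNilpotentOfLength (j := (k + 1) / 2) (by
      rw [hS, hj]
      intro X hX
      obtain ⟨hX1, hX2⟩ := NLieSuper.NSuperalgebra.lowerSeries_addCentral j hX
      rw [NLieSuper.NSuperalgebra.mem_ker_centralProj, (Submodule.mem_bot K).1 hX2, zero_smul,
        sub_zero]
      exact hI₀ (hj ▸ hX1))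
    have hiso := S.isometric hA'.skew hB'
    exact ⟨V ⧸ I, inferInstance, inferInstance, S.quotient, l, S.cochain hA'.skew hB',
      S.quotient_isFirstClass hA', hl, hlk, S.definesTStarExtension hA' hB',
      hiso.isFirstClass hA', hiso.isMetric hB', Or.inr (hiso.exists_isGradedIdeal hB)⟩
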